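/- **Theorem (Lieb–Robinson bounds for multi-commutators, Part I).** *Setting.* Let $d\in\mathbb N$, $\mathfrak L=\mathbb Z^d$ with Euclidean length $|\cdot|$, and $\Lambda_L=\{x\in\mathfrak L:|x_1|,\dots,|x_d|\le L\}$ for $L\ge 0$. Let $\mathcal U$ be the CAR $C^*$-algebra of $\mathfrak L$, generated by a unit and $\{a_x\}_{x\in\mathfrak L}$ with $a_xa_y+a_ya_x=0$, $a_xa_y^*+a_y^*a_x=\delta_{x,y}\mathbf 1$; for finite $\Lambda\subset\mathfrak L$ let $\mathcal U_\Lambda\subset\mathcal U$ be the $*$-subalgebra generated by $\mathbf 1$ and $\{a_x\}_{x\in\Lambda}$. Let $\chi_x$ be the $*$-automorphism of $\mathcal U$ with $\chi_x(a_y)=a_{x+y}$ and call $B\in\mathcal U$ even if it is fixed by the $*$-automorphism sending each $a_x$ to $-a_x$. Let $\mathbf F:[0,\infty)\to(0,\infty)$ be non-increasing with $\sum_{x\in\mathfrak L}\mathbf F(|x|)<\infty$ and $$\mathbf D=\sup_{x,y\in\mathfrak L}\sum_{z\in\mathfrak L}\frac{\mathbf F(|x-z|)\mathbf F(|z-y|)}{\mathbf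 F(|x-y|)}<\infty .$$ Let $\Psi=\{\Psi_\Lambda\}$, indexed by the finite subsets $\Lambda$ of $\mathfrak L$, be an interaction, i.e. $\Psi_\Lambda=\Psi_\Lambda^*\in\mathcal U_\Lambda$ is even and $\Psi_\emptyset=0$, with $$\|\Psi\|_{\mathcal W}=\sup_{x,y\in\mathfrak L}\ \sum_{\Lambda\supseteq\{x,y\}}\frac{\|\Psi_\Lambda\|}{\mathbf F(|x-y|)}<\infty ,$$ and let $\mathbf V=\{\mathbf V_{\{x\}}\}_{x\in\mathfrak L}$ be any potential, i.e. $\mathbf V_{\{x\}}=\mathbf V_{\{x\}}^*\in\mathcal U_{\{x\}}$ is even (no bound uniform in $x$ is assumed). Put $H_L=\sum_{\Lambda\subseteq\Lambda_L}\Psi_\Lambda+\sum_{x\in\Lambda_L}\mathbf V_{\{x\}}$ and $\tau^{(L)}_t(B)=e^{itH_L}Be^{-itH_L}$. *Trees.* $\mathcal T_2=\{\{\{0,1\}\}\}$ and $\mathcal T_{k+1}=\{\{\{j,k\}\}\cup T: 0\le j\le k-1,\ T\in\mathcal T_k\}$ for $k\ge2$. For $T\in\mathcal T_{k+1}$ and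 $1\le j\le k$, $\mathrm P_T(j)$ is the unique $i<j$ with $\{i,j\}\in T$, and $$\varkappa_T(\{(n_j,x_j)\}_{j=0}^k)=\prod_{j=1}^k\mathbf 1\big[(\Lambda_{n_j}+x_j)\cap(\Lambda_{n_{\mathrm P_T(j)}}+x_{\mathrm P_T(j)})\ne\emptyset\big].$$ $\mathcal S_{\ell,k}$ is the set of strictly increasing maps $\pi:\{\ell,\dots,k\}\to\{1,\dots,k\}$. Multi-commutators are $[B_1,B_0]^{(2)}=B_1B_0-B_0B_1$ and $[B_k,\dots,B_0]^{(k+1)}=[B_k,[B_{k-1},\dots,B_0]^{(k)}]$. *Claim.* For all $t\in\mathbb R$ and $B\in\mathcal U$ the limit $\tau_t(B)=\lim_{L\to\infty}\tau_t^{(L)}(B)$ exists in norm. Moreover, for every integer $k\ge1$, all $m_0,\dots,m_k\in\mathbb N_0$, $s_1,\dots,s_k\in\mathbb R$, $x_0,\dots,x_k\in\mathfrak L$, and all $B_j\in\mathcal U_{\Lambda_{m_j}}$ $(0\le j\le k)$ with $B_1,\dots,B_k$ even, $$\Big\|\big[\tau_{s_k}\chi_{x_k}(B_k),\dots,\tau_{s_1}\chi_{x_1}(B_1),\chi_{x_0}(B_0)\big]^{(k+1)}\Big\|\le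 2^k\prod_{j=0}^k\|B_j\|\sum_{T\in\mathcal T_{k+1}}\Big(\varkappa_T(\{(m_j,x_j)\}_{j=0}^k)+\Re_{T,\|\Psi\|_{\mathcal W}}\Big),$$ where, for $\alpha\ge0$, $$\Re_{T,\alpha}=\sum_{\ell=1}^k(2\alpha)^{k-\ell+1}\sum_{\pi\in\mathcal S_{\ell,k}}\Big(\prod_{j\in J_\pi}|s_j|e^{4\mathbf D\alpha|s_j|}\Big)\sum_{(n_j)_{j\in J_\pi}}\ \sum_{(z_j)_{j\in J_\pi}}\ \sum_{(y_j)_{j\in J_\pi}}\varkappa_T(\{(n_j,x_j)\}_{j=0}^k)\prod_{j\in J_\pi}\mathbf F(|z_j-y_j|),$$ with $J_\pi=\{\pi(\ell),\dots,\pi(k)\}$, the sums running over all integers $n_j\ge m_j+1$, all $z_j\in\Lambda_{m_j}$ and all $y_j\in\Lambda_{n_j}\setminus\Lambda_{n_j-1}$ $(j\in J_\pi)$, and $n_j=m_j$ for $j\in\{0,\dots,k\}\setminus J_\pi$. -/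

import Mathlib

open Filter Topology

noncomputable section

namespace MultiLR

section WeightedShift

variable {ι : Type*}

theorem weightedShift_sum_le (f : ι → ι) (w : ι → ℂ) (hw : ∀ i, ‖w i‖ ≤ 1)
    (hf : Set.InjOn f {i | w i ≠ 0}) (ψ : lp (fun _ : ι => ℂ) 2) (s : Finset ι) :
    ∑ i ∈ s, ‖w i * ψ (f i)‖ ^ (2 : ENNReal).toReal ≤ ‖ψ‖ ^ (2 : ENNReal).toReal := by
  classical
  have h2 : 0 < (2 : ENNReal).toReal := by norm_num
  have h1 : ∑ i ∈ s, ‖w i * ψ (f i)‖ ^ (2 : ENNReal).toReal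
      ≤ ∑ i ∈ s with w i ≠ 0, ‖ψ (f i)‖ ^ (2 : ENNReal).toReal := by
    rw [Finset.sum_filter]
    refine Finset.sum_le_sum fun i _ => ?_
    split_ifs with h
    · refine Real.rpow_le_rpow (norm_nonneg _) ?_ h2.le
      rw [norm_mul]
      exact mul_le_of_le_one_left (norm_nonneg _) (hw i)
    · have h0 : w i = 0 := not_not.mp h
      simp [h0]
  refine h1.trans ?_
  have hinj : Set.InjOn f ((s.filter fun i => w i ≠ 0 : Finset ι) : Set ι) :=
    hf.mono fun i hi => by simpa using (Finset.mem_filter.mp hi).2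
  rw [← Finset.sum_image (f := fun j => ‖ψ j‖ ^ (2 : ENNReal).toReal) hinj]
  exact lp.sum_rpow_le_norm_rpow h2 ψ _

/-- The contraction `(T ψ)(i) = w i * ψ (f i)` of `ℓ²(ι)`, where `|w| ≤ 1` and `f` is injective
on the support of `w`. -/
def weightedShift (f : ι → ι) (w : ι → ℂ) (hw : ∀ i, ‖w i‖ ≤ 1)
    (hf : Set.InjOn f {i | w i ≠ 0}) : lp (fun _ : ι => ℂ) 2 →L[ℂ] lp (fun _ : ι => ℂ) 2 :=
  LinearMap.mkContinuous
    { toFun := fun ψ => ⟨fun i => w i * ψ (f i),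
        memℓp_gen' (weightedShift_sum_le f w hw hf ψ)⟩
      map_add' := fun φ ψ => by
        ext i
        exact mul_add (w i) (φ (f i)) (ψ (f i))
      map_smul' := fun c ψ => by
        ext i
        simp [mul_left_comm] }
    1 (fun ψ => by
      rw [one_mul]
      exact lp.norm_le_of_forall_sum_le (by norm_num) (norm_nonneg _)
        (weightedShift_sum_le f w hw hf ψ))

theorem weightedShift_apply (f : ι → ι) (w : ι → ℂ) (hw : ∀ i, ‖w i‖ ≤ 1)
    (hf : Set.InjOn f {i | w i ≠ 0}) (ψ : lp (fun _ : ι => ℂ) 2) (i : ι) :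
    weightedShift f w hw hf ψ i = w i * ψ (f i) := rfl

theorem star_weightedShift {f g : ι → ι} {w v : ι → ℂ} (hw : ∀ i, ‖w i‖ ≤ 1)
    (hf : Set.InjOn f {i | w i ≠ 0}) (hv : ∀ i, ‖v i‖ ≤ 1) (hg : Set.InjOn g {i | v i ≠ 0})
    (hfg : ∀ i, w i ≠ 0 → g (f i) = i ∧ v (f i) = star (w i))
    (hgf : ∀ i, v i ≠ 0 → f (g i) = i ∧ w (g i) = star (v i)) :
    star (weightedShift f w hw hf) = weightedShift g v hv hg := by
  rw [ContinuousLinearMap.star_eq_adjoint]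
  symm
  rw [ContinuousLinearMap.eq_adjoint_iff]
  intro φ ψ
  rw [lp.inner_eq_tsum, lp.inner_eq_tsum]
  symm
  refine tsum_eq_tsum_of_ne_zero_bij (fun i => g i) ?_ ?_ ?_
  · rintro ⟨i, hi⟩ ⟨j, hj⟩ h
    have hi' : v i ≠ 0 := fun h0 => hi (by simp [weightedShift_apply, h0])
    have hj' : v j ≠ 0 := fun h0 => hj (by simp [weightedShift_apply, h0])
    exact Subtype.ext (hg hi' hj' h)
  · intro i hi
    have hi' : w i ≠ 0 := fun h0 => hi (by simp [weightedShift_apply, h0])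
    refine ⟨⟨f i, ?_⟩, (hfg i hi').1⟩
    intro h
    apply hi
    simp only [weightedShift_apply, (hfg i hi').1, (hfg i hi').2] at h ⊢
    simp at h ⊢
    tauto
  · rintro ⟨i, hi⟩
    have hi' : v i ≠ 0 := fun h0 => hi (by simp [weightedShift_apply, h0])
    simp only [weightedShift_apply, (hgf i hi').1, (hgf i hi').2]
    simp [mul_comm, mul_left_comm]

/-- The unitary `(U ψ)(i) = w i * ψ (e i)` of `ℓ²(ι)`, for a bijection `e` and phases `w`. -/
def weightedPerm (e : ι ≃ ι) (w : ι → ℂ) (hw : ∀ i, ‖w i‖ = 1) :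
    unitary (lp (fun _ : ι => ℂ) 2 →L[ℂ] lp (fun _ : ι => ℂ) 2) :=
  ⟨weightedShift e w (fun i => (hw i).le) e.injective.injOn, by
    have hs : star (weightedShift e w (fun i => (hw i).le) e.injective.injOn)
        = weightedShift e.symm (fun i => star (w (e.symm i)))
          (fun i => by rw [norm_star]; exact (hw _).le) e.symm.injective.injOn :=
      star_weightedShift _ _ _ _ (fun i _ => by simp) (fun i _ => by simp)
    have h1 : ∀ i, star (w i) * w i = 1 := fun i => by
      have := RCLike.conj_mul (w i)
      simpa [hw i] using this
    rw [Unitary.mem_iff, hs]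
    constructor <;> ext ψ i
    · change star (w (e.symm i)) * (w (e.symm i) * ψ (e (e.symm i))) = ψ i
      rw [← mul_assoc, h1, one_mul, e.apply_symm_apply]
    · change w i * (star (w (e.symm (e i))) * ψ (e.symm (e i))) = ψ i
      rw [e.symm_apply_apply, ← mul_assoc, mul_comm (w i), h1, one_mul]⟩

theorem weightedPerm_apply (e : ι ≃ ι) (w : ι → ℂ) (hw : ∀ i, ‖w i‖ = 1)
    (ψ : lp (fun _ : ι => ℂ) 2) (i : ι) :
    (weightedPerm e w hw : lp (fun _ : ι => ℂ) 2 →L[ℂ] lp (fun _ : ι => ℂ) 2) ψ i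
      = w i * ψ (e i) := rfl

end WeightedShift


/-- The lattice `ℤᵈ`. -/
abbrev Site (d : ℕ) : Type := Fin d → ℤ

/-- The Euclidean length `|x|` of a lattice site. -/
def len {d : ℕ} (x : Site d) : ℝ := Real.sqrt (∑ i, (x i : ℝ) ^ 2)

/-- The cubic box `Λ_L = {x : |x₁|, …, |x_d| ≤ L}`. -/
def box (d : ℕ) (L : ℝ) : Finset (Site d) :=
  Finset.Icc (fun _ => -⌊L⌋) (fun _ => ⌊L⌋)

theorem mem_box {d : ℕ} {L : ℝ} {x : Site d} : x ∈ box d L ↔ ∀ i, |(x i : ℝ)| ≤ L := by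
  simp only [box, Finset.mem_Icc, Pi.le_def, ← forall_and, abs_le]
  refine forall_congr' fun i => and_congr ?_ Int.le_floor
  rw [neg_le, Int.le_floor, Int.cast_neg, neg_le]

/-- The translated box `Λ_n + x`. -/
def shiftedBox {d : ℕ} (n : ℕ) (x : Site d) : Finset (Site d) :=
  (box d n).map (addRightEmbedding x)

/-! ### The lattice CAR algebra in its Fock representation

The antisymmetric Fock space over `ℓ²(ℤᵈ)` is `ℓ²` of the set of finite subsets `S` of `ℤᵈ`: the
basis vector `e_S` is the normalized antisymmetric product of the one-particle vectors `e_y`,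
`y ∈ S`, taken in lexicographic order. -/

/-- The fermion Fock space over `ℓ²(ℤᵈ)`, in the occupation number basis. -/
abbrev Fock (d : ℕ) : Type := lp (fun _ : Finset (Site d) => ℂ) 2

/-- The strict lexicographic order of `ℤᵈ`. -/
def Precedes {d : ℕ} (y x : Site d) : Prop := ∃ i, (∀ j < i, y j = x j) ∧ y i < x i

theorem Precedes.asymm {d : ℕ} {x y : Site d} (h : Precedes x y) : ¬ Precedes y x := by
  rintro ⟨j, hj, hlt'⟩
  obtain ⟨i, hi, hlt⟩ := h
  rcases lt_trichotomy i j with h | h | h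
  · have := hj i h
    omega
  · subst h
    omega
  · have := hi j h
    omega

theorem precedes_total {d : ℕ} {x y : Site d} (h : x ≠ y) : Precedes x y ∨ Precedes y x := by
  classical
  have hne : (Finset.univ.filter fun i => x i ≠ y i).Nonempty := by
    obtain ⟨i, hi⟩ := Function.ne_iff.mp h
    exact ⟨i, by simpa using hi⟩
  obtain ⟨i, hi, hmin⟩ := Finset.exists_min_image _ id hne
  have heq : ∀ j < i, x j = y j := fun j hj => by
    by_contra hc
    exact absurd (hmin j (by simpa using hc)) (not_le.mpr hj)
  rcases lt_or_gt_of_ne (by simpa using hi : x i ≠ y i) with hlt | hlt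
  · exact Or.inl ⟨i, heq, hlt⟩
  · exact Or.inr ⟨i, fun j hj => (heq j hj).symm, hlt⟩

open Classical in
/-- The sign of moving the particle at `x` past the particles of `S` that precede it. -/
def fermiSign {d : ℕ} (x : Site d) (S : Finset (Site d)) : ℂ :=
  (-1) ^ (S.filter fun y => Precedes y x).card

theorem norm_fermiSign {d : ℕ} (x : Site d) (S : Finset (Site d)) : ‖fermiSign x S‖ = 1 := by
  simp [fermiSign]

/-- The annihilation operator at `x`: it sends `e_T` to `± e_{T \ {x}}` if `x ∈ T`, and to `0`
otherwise. -/
def annihilation {d : ℕ} (x : Site d) : Fock d →L[ℂ] Fock d :=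
  weightedShift (fun S => insert x S) (fun S => if x ∈ S then 0 else fermiSign x S)
    (fun S => by
      split_ifs
      · simp
      · exact (norm_fermiSign x S).le)
    (fun S hS T hT h => by
      have hS' : x ∉ S := fun hx => hS (if_pos hx)
      have hT' : x ∉ T := fun hx => hT (if_pos hx)
      rw [← Finset.erase_insert hS', ← Finset.erase_insert hT']
      exact congrArg (fun U => Finset.erase U x) h)

theorem annihilation_apply {d : ℕ} (x : Site d) (ψ : Fock d) (S : Finset (Site d)) :
    annihilation x ψ S = (if x ∈ S then 0 else fermiSign x S) * ψ (insert x S) := rfl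

theorem star_annihilation_apply {d : ℕ} (x : Site d) (ψ : Fock d) (S : Finset (Site d)) :
    (star (annihilation x) : Fock d →L[ℂ] Fock d) ψ S
      = (if x ∈ S then fermiSign x (S.erase x) else 0) * ψ (S.erase x) := by
  have hv : ∀ S : Finset (Site d), ‖if x ∈ S then fermiSign x (S.erase x) else 0‖ ≤ 1 := by
    intro S
    split_ifs
    · exact (norm_fermiSign _ _).le
    · simp
  have hg : Set.InjOn (fun S : Finset (Site d) => S.erase x)
      {S | (if x ∈ S then fermiSign x (S.erase x) else 0) ≠ 0} := by
    intro S hS T hT h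
    have hS' : x ∈ S := by_contra fun hx => hS (if_neg hx)
    have hT' : x ∈ T := by_contra fun hx => hT (if_neg hx)
    rw [← Finset.insert_erase hS', ← Finset.insert_erase hT']
    exact congrArg (fun U => insert x U) h
  have hstar : ∀ S : Finset (Site d), star (fermiSign x S) = fermiSign x S := by
    intro S
    simp [fermiSign]
  have hs : star (annihilation x) = weightedShift (fun S : Finset (Site d) => S.erase x)
      (fun S => if x ∈ S then fermiSign x (S.erase x) else 0) hv hg := by
    refine star_weightedShift _ _ hv hg ?_ ?_
    · intro S hS
      have hS' : x ∉ S := fun hx => hS (if_pos hx)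
      simp [hS', hstar]
    · intro S hS
      have hS' : x ∈ S := by_contra fun hx => hS (if_neg hx)
      simp [hS', hstar]
  rw [hs]
  rfl

theorem fermiSign_sq {d : ℕ} (x : Site d) (S : Finset (Site d)) :
    fermiSign x S * fermiSign x S = 1 := by
  simp [fermiSign, ← mul_pow]

open Classical in
theorem fermiSign_insert {d : ℕ} (x y : Site d) {S : Finset (Site d)} (hy : y ∉ S) :
    fermiSign x (insert y S) = (if Precedes y x then -1 else 1) * fermiSign x S := by
  unfold fermiSign
  rw [Finset.filter_insert]
  split_ifs with h
  · rw [Finset.card_insert_of_notMem (by simp [hy]), pow_succ, mul_comm]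
  · rw [one_mul]

theorem fermiSign_swap {d : ℕ} {x y : Site d} (hxy : x ≠ y) {S : Finset (Site d)}
    (hx : x ∉ S) (hy : y ∉ S) :
    fermiSign x S * fermiSign y (insert x S) = -(fermiSign y S * fermiSign x (insert y S)) := by
  rw [fermiSign_insert y x hx, fermiSign_insert x y hy]
  rcases precedes_total hxy with h | h
  · rw [if_pos h, if_neg h.asymm]
    ring
  · rw [if_neg h.asymm, if_pos h]
    ring

/-- The relation `a_x a_y + a_y a_x = 0`. -/
theorem annihilation_anticomm {d : ℕ} (x y : Site d) :
    annihilation x * annihilation y + annihilation y * annihilation x = 0 := by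
  ext ψ S
  change annihilation x (annihilation y ψ) S + annihilation y (annihilation x ψ) S = 0
  simp only [annihilation_apply, Finset.mem_insert]
  by_cases hxy : x = y
  · subst hxy
    simp
  by_cases hx : x ∈ S
  · simp [hx]
  by_cases hy : y ∈ S
  · simp [hy]
  have hyx : y ≠ x := fun h => hxy h.symm
  simp only [hx, hy, hxy, hyx, or_false, if_false, Finset.insert_comm y x S]
  rw [← mul_assoc, ← mul_assoc, fermiSign_swap hxy hx hy]
  ring

/-- The relation `a_x a_y^* + a_y^* a_x = δ_{x,y} 1`. -/
theorem annihilation_star_anticomm {d : ℕ} (x y : Site d) :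
    annihilation x * star (annihilation y) + star (annihilation y) * annihilation x
      = if x = y then 1 else 0 := by
  ext ψ S
  change annihilation x (star (annihilation y) ψ) S + star (annihilation y) (annihilation x ψ) S
    = (if x = y then (1 : Fock d →L[ℂ] Fock d) else 0) ψ S
  simp only [annihilation_apply, star_annihilation_apply, Finset.mem_insert, Finset.mem_erase]
  by_cases hxy : x = y
  · subst hxy
    by_cases hx : x ∈ S
    · simp [hx, ← mul_assoc, fermiSign_sq]
    · simp [hx, ← mul_assoc, fermiSign_sq]
  · have hyx : y ≠ x := fun h => hxy h.symm
    by_cases hx : x ∈ S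
    · simp [hx, hxy]
    by_cases hy : y ∈ S
    · obtain ⟨T, hyT, rfl⟩ : ∃ T, y ∉ T ∧ insert y T = S :=
        ⟨S.erase y, Finset.notMem_erase y S, Finset.insert_erase hy⟩
      have hxT : x ∉ T := fun h => hx (Finset.mem_insert_of_mem h)
      have h1 : (insert x (insert y T)).erase y = insert x T := by
        rw [Finset.insert_comm, Finset.erase_insert]
        simp [hyx, hyT]
      have h2 := fermiSign_swap hxy hxT hyT
      simp only [hx, hxy, hyT, h1, Finset.erase_insert hyT, if_false, if_true, or_true,
        Finset.mem_insert, and_false, zero_apply, or_false]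
      have h3 := fermiSign_sq y T
      have h4 := fermiSign_sq y (insert x T)
      have h5 : fermiSign x (insert y T) * fermiSign y (insert x T)
          = -(fermiSign y T * fermiSign x T) := by
        linear_combination fermiSign y (insert x T) * fermiSign y T * h2
          - fermiSign x (insert y T) * fermiSign y (insert x T) * h3
          - fermiSign x T * fermiSign y T * h4
      rw [← mul_assoc, h5]
      simp
      ring
    · simp [hx, hy, hxy, hyx]

/-- The `*`-automorphism of `B(F)` implemented by a unitary. -/
def conjAut {d : ℕ} (u : unitary (Fock d →L[ℂ] Fock d)) :
    (Fock d →L[ℂ] Fock d) ≃⋆ₐ[ℂ] (Fock d →L[ℂ] Fock d) :=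
  Unitary.conjStarAlgAut ℂ _ u

/-- The CAR algebra `𝒰` as a `C*`-subalgebra of `B(F)`: the norm closure of the `*`-algebra
generated by the unit and all annihilation operators. -/
def carSubalgebra (d : ℕ) : StarSubalgebra ℂ (Fock d →L[ℂ] Fock d) :=
  (StarAlgebra.adjoin ℂ (Set.range (annihilation (d := d)))).topologicalClosure

/-- The CAR `C*`-algebra `𝒰` of the lattice `ℤᵈ`. -/
abbrev CAR (d : ℕ) : Type := ↥(carSubalgebra d)

instance isClosed_carSubalgebra (d : ℕ) :
    IsClosed (carSubalgebra d : Set (Fock d →L[ℂ] Fock d)) :=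
  StarSubalgebra.isClosed_topologicalClosure _

instance completeSpace_CAR (d : ℕ) : CompleteSpace (CAR d) :=
  (isClosed_carSubalgebra d).completeSpace_coe

theorem annihilation_mem {d : ℕ} (x : Site d) : annihilation x ∈ carSubalgebra d :=
  StarSubalgebra.le_topologicalClosure _ (StarAlgebra.subset_adjoin ℂ _ ⟨x, rfl⟩)

/-- The generator `a_x` of `𝒰`. -/
def ann {d : ℕ} (x : Site d) : CAR d := ⟨annihilation x, annihilation_mem x⟩

theorem conjAut_mem {d : ℕ} (u : unitary (Fock d →L[ℂ] Fock d))
    (h : ∀ x : Site d, conjAut u (annihilation x) ∈ carSubalgebra d)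
    {b : Fock d →L[ℂ] Fock d} (hb : b ∈ carSubalgebra d) : conjAut u b ∈ carSubalgebra d := by
  have hc : Continuous (conjAut u) := by
    change Continuous fun b : Fock d →L[ℂ] Fock d =>
      (u : Fock d →L[ℂ] Fock d) * b * (star u : Fock d →L[ℂ] Fock d)
    fun_prop
  let φ : (Fock d →L[ℂ] Fock d) →⋆ₐ[ℂ] (Fock d →L[ℂ] Fock d) := (conjAut u).toStarAlgHom
  have hle : carSubalgebra d ≤ (carSubalgebra d).comap φ := by
    refine StarSubalgebra.topologicalClosure_minimal ?_ ?_
    · refine StarAlgebra.adjoin_le ?_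
      rintro _ ⟨x, rfl⟩
      exact h x
    · exact (isClosed_carSubalgebra d).preimage hc
  exact hle hb

/-- The restriction to `𝒰` of the automorphism implemented by a unitary `u` for which
`u · u^*` and `u^* · u` send all `a_x` to elements of `𝒰`. -/
def restrictAut {d : ℕ} (u : unitary (Fock d →L[ℂ] Fock d))
    (h : ∀ x : Site d, conjAut u (annihilation x) ∈ carSubalgebra d)
    (h' : ∀ x : Site d, conjAut (star u) (annihilation x) ∈ carSubalgebra d) :
    CAR d ≃⋆ₐ[ℂ] CAR d where
  toFun b := ⟨conjAut u b, conjAut_mem u h b.2⟩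
  invFun b := ⟨conjAut (star u) b, conjAut_mem (star u) h' b.2⟩
  left_inv b := Subtype.ext (by simp [conjAut, mul_assoc]; simp [← mul_assoc])
  right_inv b := Subtype.ext (by simp [conjAut, mul_assoc]; simp [← mul_assoc])
  map_mul' b c := Subtype.ext (map_mul (conjAut u) _ _)
  map_add' b c := Subtype.ext (map_add (conjAut u) _ _)
  map_star' b := Subtype.ext (map_star (conjAut u) _)
  map_smul' r b := Subtype.ext (map_smul (conjAut u) r _)


/-- The unitary of Fock space that sends `e_S` to `e_{S + v}`. -/
def translationUnitary {d : ℕ} (v : Site d) : unitary (Fock d →L[ℂ] Fock d) :=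
  weightedPerm (Equiv.finsetCongr (Equiv.addRight (-v))) (fun _ => 1) (fun _ => by simp)

theorem star_translationUnitary {d : ℕ} (v : Site d) :
    star (translationUnitary v) = translationUnitary (-v) := by
  rw [Unitary.star_eq_inv, inv_eq_iff_mul_eq_one]
  ext ψ S
  change (1 : ℂ) * (1 * ψ _) = ψ S
  rw [one_mul, one_mul]
  refine congrArg ψ ?_
  ext x
  simp

theorem conjAut_translationUnitary {d : ℕ} (v y : Site d) :
    conjAut (translationUnitary v) (annihilation y) = annihilation (y + v) := by
  classical
  have h : (translationUnitary v : Fock d →L[ℂ] Fock d) * annihilation y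
      = annihilation (y + v) * translationUnitary v := by
    ext ψ S
    have hins : (insert (y + v) S).map (Equiv.addRight (-v)).toEmbedding
        = insert y (S.map (Equiv.addRight (-v)).toEmbedding) := by
      simp [Finset.map_insert]
    have hmem : y ∈ S.map (Equiv.addRight (-v)).toEmbedding ↔ y + v ∈ S := by
      simp
    have hsign : fermiSign y (S.map (Equiv.addRight (-v)).toEmbedding) = fermiSign (y + v) S := by
      unfold fermiSign
      rw [Finset.filter_map, Finset.card_map]
      congr 3
      ext z
      simp only [Function.comp, Precedes, Equiv.toEmbedding_apply, Equiv.coe_addRight,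
        Pi.add_apply, Pi.neg_apply]
      refine exists_congr fun i => and_congr (forall_congr' fun j => forall_congr' fun _ => ?_) ?_
      · constructor <;> intro h <;> omega
      · constructor <;> intro h <;> omega
    change 1 * ((if y ∈ S.map (Equiv.addRight (-v)).toEmbedding then 0
        else fermiSign y (S.map (Equiv.addRight (-v)).toEmbedding))
          * ψ (insert y (S.map (Equiv.addRight (-v)).toEmbedding)))
      = (if y + v ∈ S then 0 else fermiSign (y + v) S)
          * (1 * ψ ((insert (y + v) S).map (Equiv.addRight (-v)).toEmbedding))
    rw [hins, hsign, one_mul, one_mul]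
    simp only [hmem]
  change (translationUnitary v : Fock d →L[ℂ] Fock d) * annihilation y
      * (star (translationUnitary v) : Fock d →L[ℂ] Fock d) = _
  rw [h, mul_assoc, Unitary.mul_star_self_of_mem (SetLike.coe_mem _), mul_one]

/-- The lattice translation `χ_v`, the `*`-automorphism of `𝒰` with `χ_v(a_y) = a_{y+v}`. -/
def translation {d : ℕ} (v : Site d) : CAR d ≃⋆ₐ[ℂ] CAR d :=
  restrictAut (translationUnitary v)
    (fun x => by
      rw [conjAut_translationUnitary]
      exact annihilation_mem _)
    (fun x => by
      rw [star_translationUnitary, conjAut_translationUnitary]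
      exact annihilation_mem _)

theorem translation_ann {d : ℕ} (v y : Site d) : translation v (ann y) = ann (y + v) :=
  Subtype.ext (conjAut_translationUnitary v y)

/-- The unitary `exp(iθN)` of Fock space, with `N` the particle number operator. -/
def gaugeUnitary (d : ℕ) (θ : ℝ) : unitary (Fock d →L[ℂ] Fock d) :=
  weightedPerm (Equiv.refl _) (fun S => Complex.exp (θ * S.card * Complex.I))
    (fun S => by
      have := Complex.norm_exp_ofReal_mul_I (θ * S.card)
      push_cast at this
      exact this)

theorem star_gaugeUnitary (d : ℕ) (θ : ℝ) : star (gaugeUnitary d θ) = gaugeUnitary d (-θ) := by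
  rw [Unitary.star_eq_inv, inv_eq_iff_mul_eq_one]
  ext ψ S
  change Complex.exp (θ * S.card * Complex.I) *
    (Complex.exp ((-θ : ℝ) * S.card * Complex.I) * ψ S) = ψ S
  rw [← mul_assoc, ← Complex.exp_add]
  simp

theorem conjAut_gaugeUnitary {d : ℕ} (θ : ℝ) (y : Site d) :
    conjAut (gaugeUnitary d θ) (annihilation y)
      = Complex.exp (-(θ * Complex.I)) • annihilation y := by
  have h : (gaugeUnitary d θ : Fock d →L[ℂ] Fock d) * annihilation y
      = Complex.exp (-(θ * Complex.I)) • annihilation y * gaugeUnitary d θ := by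
    ext ψ S
    change Complex.exp (θ * S.card * Complex.I) *
        ((if y ∈ S then 0 else fermiSign y S) * ψ (insert y S))
      = Complex.exp (-(θ * Complex.I)) * ((if y ∈ S then 0 else fermiSign y S) *
        (Complex.exp (θ * (insert y S).card * Complex.I) * ψ (insert y S)))
    by_cases hy : y ∈ S
    · simp [hy]
    · rw [Finset.card_insert_of_notMem hy]
      have : Complex.exp (θ * S.card * Complex.I) = Complex.exp (-(θ * Complex.I)) *
          Complex.exp (θ * ((S.card + 1 : ℕ) : ℂ) * Complex.I) := by
        rw [← Complex.exp_add]
        congr 1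
        push_cast
        ring
      rw [this]
      ring
  change (gaugeUnitary d θ : Fock d →L[ℂ] Fock d) * annihilation y
      * (star (gaugeUnitary d θ) : Fock d →L[ℂ] Fock d) = _
  rw [h, mul_assoc, Unitary.mul_star_self_of_mem (SetLike.coe_mem _), mul_one]

/-- The gauge automorphism `σ_θ`, the `*`-automorphism of `𝒰` with `σ_θ(a_y) = e^{-iθ} a_y`. -/
def gauge {d : ℕ} (θ : ℝ) : CAR d ≃⋆ₐ[ℂ] CAR d :=
  restrictAut (gaugeUnitary d θ)
    (fun x => by
      rw [conjAut_gaugeUnitary]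
      exact (carSubalgebra d).smul_mem (annihilation_mem _) _)
    (fun x => by
      rw [star_gaugeUnitary, conjAut_gaugeUnitary]
      exact (carSubalgebra d).smul_mem (annihilation_mem _) _)

theorem gauge_ann {d : ℕ} (θ : ℝ) (y : Site d) :
    gauge θ (ann y) = Complex.exp (-(θ * Complex.I)) • ann y :=
  Subtype.ext (conjAut_gaugeUnitary θ y)

/-- The local algebra `𝒰_Λ`: all finite sums of monomials in `1`, `a_x`, `a_x^*`, `x ∈ Λ`. -/
def localAlgebra {d : ℕ} (Λ : Finset (Site d)) : StarSubalgebra ℂ (CAR d) :=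
  StarAlgebra.adjoin ℂ (ann '' (Λ : Set (Site d)))

/-- Even elements: those fixed by `σ_π`. -/
def IsEven {d : ℕ} (B : CAR d) : Prop := gauge Real.pi B = B

/-! ### Interactions, potentials and dynamics -/

/-- An interaction: a family of even self-adjoint elements `Ψ_Λ ∈ 𝒰_Λ` with `Ψ_∅ = 0`. -/
structure Interaction (d : ℕ) where
  /-- The element `Ψ_Λ`. -/
  term : Finset (Site d) → CAR d
  isLocal : ∀ Λ, term Λ ∈ localAlgebra Λ
  isEven : ∀ Λ, IsEven (term Λ)
  isSelfAdjoint : ∀ Λ, IsSelfAdjoint (term Λ)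
  term_empty : term ∅ = 0

/-- A potential: a family of even self-adjoint elements `V_{x} ∈ 𝒰_{x}`. -/
structure Potential (d : ℕ) where
  /-- The element `V_{x}`. -/
  term : Site d → CAR d
  isLocal : ∀ x, term x ∈ localAlgebra {x}
  isEven : ∀ x, IsEven (term x)
  isSelfAdjoint : ∀ x, IsSelfAdjoint (term x)

/-- The convolution constant `D = sup_{x,y} ∑_z F(|x-z|) F(|z-y|) / F(|x-y|)` in `[0,∞]`. -/
def eConvConst (d : ℕ) (F : ℝ → ℝ) : ENNReal :=
  ⨆ (x : Site d) (y : Site d),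
    ∑' z : Site d, ENNReal.ofReal (F (len (x - z)) * F (len (z - y)) / F (len (x - y)))

/-- The convolution constant `D` as a real number. -/
def convConst (d : ℕ) (F : ℝ → ℝ) : ℝ := (eConvConst d F).toReal

/-- Decay functions: positive and non-increasing on `[0,∞)`, summable on the lattice, with finite
convolution constant. -/
structure IsDecayFunction (d : ℕ) (F : ℝ → ℝ) : Prop where
  pos : ∀ r, 0 ≤ r → 0 < F r
  antitone : AntitoneOn F (Set.Ici 0)
  summable : Summable fun x : Site d => F (len x)
  conv_lt_top : eConvConst d F < ⊤

/-- The norm `‖Ψ‖_𝒲 = sup_{x,y} ∑_{Λ ⊇ {x,y}} ‖Ψ_Λ‖ / F(|x-y|)` in `[0,∞]`. -/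
def Interaction.eNormW {d : ℕ} (F : ℝ → ℝ) (Ψ : Interaction d) : ENNReal :=
  ⨆ (x : Site d) (y : Site d),
    ∑' Λ : {Λ : Finset (Site d) // {x, y} ⊆ Λ}, ENNReal.ofReal (‖Ψ.term Λ‖ / F (len (x - y)))

/-- The norm `‖Ψ‖_𝒲` as a real number. -/
def Interaction.normW {d : ℕ} (F : ℝ → ℝ) (Ψ : Interaction d) : ℝ := (Ψ.eNormW F).toReal

/-- The Hamiltonian `H_L` of the box `Λ_L`. -/
def hamiltonian {d : ℕ} (Ψ : Interaction d) (V : Potential d) (L : ℝ) : CAR d :=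
  ∑ Λ ∈ (box d L).powerset, Ψ.term Λ + ∑ x ∈ box d L, V.term x

/-- The finite-volume dynamics `τ_t^{(L)}(B) = exp(itH_L) B exp(-itH_L)`. -/
def finiteDynamics {d : ℕ} (Ψ : Interaction d) (V : Potential d) (L t : ℝ) (B : CAR d) : CAR d :=
  NormedSpace.exp ((Complex.I * t) • hamiltonian Ψ V L) * B *
    NormedSpace.exp (-((Complex.I * t) • hamiltonian Ψ V L))

/-- The infinite-volume dynamics `τ_t(B) = lim_{L → ∞} τ_t^{(L)}(B)`. -/
def dynamics {d : ℕ} (Ψ : Interaction d) (V : Potential d) (t : ℝ) (B : CAR d) : CAR d :=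
  limUnder atTop fun L : ℝ => finiteDynamics Ψ V L t B

/-- The multi-commutator `[B_k, …, B_1, B_0]^{(k+1)}`. -/
def multiCommutator {A : Type*} [Ring A] (B : ℕ → A) : ℕ → A
  | 0 => B 0
  | k + 1 => B (k + 1) * multiCommutator B k - multiCommutator B k * B (k + 1)

/-! ### Trees and the remainder -/

/-- `trees k` is the set `𝒯_{k+1}` of trees with vertices `0, …, k`, as sets of bonds. -/
def trees : ℕ → Finset (Finset (Sym2 ℕ))
  | 0 => {∅}
  | k + 1 => (Finset.range (k + 1) ×ˢ trees k).image fun p => insert s(p.1, k + 1) p.2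

/-- The map `P_T`: for a tree `T` as above and a vertex `j ≥ 1`, the (unique) vertex `i < j` with
`{i, j} ∈ T`. -/
def parent (T : Finset (Sym2 ℕ)) (j : ℕ) : ℕ := sInf {i | i < j ∧ s(i, j) ∈ T}

/-- `ϰ_T({(n_j, x_j)}_{j=0}^k)`, the indicator that all boxes `Λ_{n_j} + x_j` and
`Λ_{n_i} + x_i`, `i = P_T(j)`, overlap. -/
def overlap {d : ℕ} (k : ℕ) (T : Finset (Sym2 ℕ)) (n : ℕ → ℕ) (x : ℕ → Site d) : ℝ :=
  ∏ j ∈ Finset.Icc 1 k,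
    if (shiftedBox (n j) (x j) ∩ shiftedBox (n (parent T j)) (x (parent T j))).Nonempty
    then 1 else 0

/-- The set `𝒮_{ℓ,k}` of strictly increasing maps `{ℓ, …, k} → {1, …, k}`. -/
abbrev IncMaps (l k : ℕ) : Type := {π : Finset.Icc l k → Finset.Icc 1 k // StrictMono π}

instance fintypeIncMaps (l k : ℕ) : Fintype (IncMaps l k) := Fintype.ofFinite _

/-- The remainder `ℜ_{T,α}`. The sum over `n` runs over all families `n_{π(i)} ≥ m_{π(i)} + 1`,
`i ∈ {ℓ, …, k}`; `Function.extend` sets `n_j = m_j` for `j` outside the range of `π`. -/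
def remainder {d : ℕ} (F : ℝ → ℝ) (k : ℕ) (T : Finset (Sym2 ℕ)) (m : ℕ → ℕ) (s : ℕ → ℝ)
    (x : ℕ → Site d) (α : ℝ) : ℝ :=
  ∑ l ∈ Finset.Icc 1 k, (2 * α) ^ (k - l + 1) *
    ∑ π : IncMaps l k,
      (∏ i : Finset.Icc l k, |s (π.1 i)| * Real.exp (4 * convConst d F * α * |s (π.1 i)|)) *
      ∑' n : (i : Finset.Icc l k) → {n : ℕ // m (π.1 i) + 1 ≤ n},
        ∑ z ∈ Fintype.piFinset fun i : Finset.Icc l k => box d (m (π.1 i)),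
          ∑ y ∈ Fintype.piFinset fun i : Finset.Icc l k =>
              box d ((n i : ℕ) : ℝ) \ box d (((n i : ℕ) : ℝ) - 1),
            overlap k T (Function.extend (fun i => (π.1 i : ℕ)) (fun i => (n i : ℕ)) m) x *
              ∏ i : Finset.Icc l k, F (len (z i - y i))

end MultiLR

end

open Filter Topology

noncomputable section

namespace MultiLR

section Evolution

variable {A : Type*} [CStarAlgebra A]

/-- The evolution `B ↦ exp(itH) B exp(-itH)` generated by `H`. -/
def evolve (H : A) (t : ℝ) (B : A) : A :=
  NormedSpace.exp ((Complex.I * t) • H) * B * NormedSpace.exp (-((Complex.I * t) • H))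

/-- The commutator `[B, C]`. -/
def comm (B C : A) : A := B * C - C * B

theorem comm_add (B C D : A) : comm B (C + D) = comm B C + comm B D := by
  simp only [comm, mul_add, add_mul]
  abel

theorem neg_comm (B C : A) : comm (-B) C = -comm B C := by
  simp only [comm, neg_mul, mul_neg, neg_sub, sub_neg_eq_add]
  abel

theorem sum_comm_left {ι : Type*} (s : Finset ι) (B : ι → A) (C : A) :
    comm (∑ i ∈ s, B i) C = ∑ i ∈ s, comm (B i) C := by
  simp only [comm, Finset.sum_mul, Finset.mul_sum, Finset.sum_sub_distrib]

theorem comm_eq_zero_of_commute {B C : A} (h : Commute B C) : comm B C = 0 :=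
  sub_eq_zero.mpr h.eq

theorem exp_mul_exp_neg_self (x : A) : NormedSpace.exp x * NormedSpace.exp (-x) = 1 := by
  let : NormedAlgebra ℚ A := NormedAlgebra.restrictScalars ℚ ℂ A
  rw [← NormedSpace.exp_add_of_commute (Commute.refl x).neg_right, add_neg_cancel,
    NormedSpace.exp_zero]

theorem exp_neg_mul_exp_self (x : A) : NormedSpace.exp (-x) * NormedSpace.exp x = 1 := by
  simpa using exp_mul_exp_neg_self (-x)

theorem exp_smul_mem_unitary {H : A} (hH : IsSelfAdjoint H) (t : ℝ) :
    NormedSpace.exp ((Complex.I * t) • H) ∈ unitary A := by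
  let : NormedAlgebra ℚ A := NormedAlgebra.restrictScalars ℚ ℂ A
  refine NormedSpace.exp_mem_unitary_of_mem_skewAdjoint ?_
  rw [skewAdjoint.mem_iff, star_smul, hH.star_eq, ← neg_smul]
  simp

theorem exp_neg_smul_mem_unitary {H : A} (hH : IsSelfAdjoint H) (t : ℝ) :
    NormedSpace.exp (-((Complex.I * t) • H)) ∈ unitary A := by
  rw [← smul_neg]
  exact exp_smul_mem_unitary hH.neg t

theorem norm_evolve {H : A} (hH : IsSelfAdjoint H) (t : ℝ) (B : A) : ‖evolve H t B‖ = ‖B‖ := by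
  rw [evolve, CStarRing.norm_mul_mem_unitary _ (exp_neg_smul_mem_unitary hH t),
    CStarRing.norm_mem_unitary_mul _ (exp_smul_mem_unitary hH t)]

theorem evolve_zero_time (H B : A) : evolve H 0 B = B := by
  simp [evolve]

theorem evolve_sub (H : A) (t : ℝ) (B C : A) :
    evolve H t (B - C) = evolve H t B - evolve H t C := by
  simp [evolve, mul_sub, sub_mul]

theorem evolve_sum {ι : Type*} (H : A) (t : ℝ) (s : Finset ι) (B : ι → A) :
    evolve H t (∑ i ∈ s, B i) = ∑ i ∈ s, evolve H t (B i) := by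
  simp [evolve, Finset.mul_sum, Finset.sum_mul]

theorem evolve_mul (H : A) (t : ℝ) (B C : A) :
    evolve H t (B * C) = evolve H t B * evolve H t C := by
  have h := exp_neg_mul_exp_self ((Complex.I * t) • H)
  simp only [evolve]
  calc _ = NormedSpace.exp ((Complex.I * t) • H) * B * 1 * C
        * NormedSpace.exp (-((Complex.I * t) • H)) := by noncomm_ring
    _ = _ := by rw [← h]; noncomm_ring

theorem evolve_comm (H : A) (t : ℝ) (B C : A) :
    evolve H t (comm B C) = comm (evolve H t B) (evolve H t C) := by
  simp only [comm, evolve_sub, evolve_mul]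

theorem evolve_neg_generator (H : A) (t : ℝ) (B : A) : evolve (-H) t B = evolve H (-t) B := by
  simp [evolve]

theorem evolve_evolve_neg (H : A) (t : ℝ) (B : A) : evolve H t (evolve H (-t) B) = B := by
  have h := exp_mul_exp_neg_self ((Complex.I * t) • H)
  simp only [evolve, Complex.ofReal_neg, mul_neg, neg_smul, neg_neg]
  calc _ = (NormedSpace.exp ((Complex.I * t) • H) * NormedSpace.exp (-((Complex.I * t) • H))) * B
        * (NormedSpace.exp ((Complex.I * t) • H) * NormedSpace.exp (-((Complex.I * t) • H))) := by
          noncomm_ring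
    _ = B := by rw [h, one_mul, mul_one]

theorem evolve_neg_evolve (H : A) (t : ℝ) (B : A) : evolve H (-t) (evolve H t B) = B := by
  simpa using evolve_evolve_neg H (-t) B

theorem norm_comm_evolve {H : A} (hH : IsSelfAdjoint H) (t : ℝ) (B C : A) :
    ‖comm (evolve H t B) C‖ = ‖comm B (evolve H (-t) C)‖ := by
  rw [← norm_evolve hH t (comm B (evolve H (-t) C)), evolve_comm, evolve_evolve_neg]

theorem norm_comm_le (B C : A) : ‖comm B C‖ ≤ 2 * ‖B‖ * ‖C‖ := by
  rw [comm]
  calc _ ≤ ‖B * C‖ + ‖C * B‖ := norm_sub_le _ _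
    _ ≤ ‖B‖ * ‖C‖ + ‖C‖ * ‖B‖ := add_le_add (norm_mul_le _ _) (norm_mul_le _ _)
    _ = _ := by ring

theorem norm_comm_symm (B C : A) : ‖comm B C‖ = ‖comm C B‖ :=
  norm_sub_rev _ _

/-- A part of the generator that commutes with everything else does not contribute. -/
theorem evolve_add_of_commute {K N B : A} (hKN : Commute K N) (hNB : Commute N B) (t : ℝ) :
    evolve (K + N) t B = evolve K t B := by
  let : NormedAlgebra ℚ A := NormedAlgebra.restrictScalars ℚ ℂ A
  have h1 : Commute ((Complex.I * t) • K) ((Complex.I * t) • N) :=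
    (hKN.smul_left _).smul_right _
  have h2 : Commute B (NormedSpace.exp ((Complex.I * t) • N)) :=
    (hNB.symm.smul_right _).exp_right
  have h3 := exp_mul_exp_neg_self ((Complex.I * t) • N)
  rw [evolve, smul_add, NormedSpace.exp_add_of_commute h1, neg_add_rev,
    NormedSpace.exp_add_of_commute h1.symm.neg_left.neg_right, evolve]
  calc _ = NormedSpace.exp ((Complex.I * t) • K) * (NormedSpace.exp ((Complex.I * t) • N) * B)
        * NormedSpace.exp (-((Complex.I * t) • N)) * NormedSpace.exp (-((Complex.I * t) • K)) := by
        noncomm_ring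
    _ = NormedSpace.exp ((Complex.I * t) • K) * B * (NormedSpace.exp ((Complex.I * t) • N)
        * NormedSpace.exp (-((Complex.I * t) • N))) * NormedSpace.exp (-((Complex.I * t) • K)) := by
        rw [← h2.eq]; noncomm_ring
    _ = _ := by rw [h3, mul_one]

theorem evolve_mem {S : StarSubalgebra ℂ A} (hS : IsClosed (S : Set A)) {H B : A} (hH : H ∈ S)
    (hB : B ∈ S) (t : ℝ) : evolve H t B ∈ S := by
  let : NormedAlgebra ℚ A := NormedAlgebra.restrictScalars ℚ ℂ A
  have hx : (Complex.I * t) • H ∈ S := S.smul_mem hH _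
  exact mul_mem (mul_mem (NormedSpace.exp_mem (R := ℂ) hS hx) hB)
    (NormedSpace.exp_mem (R := ℂ) hS (neg_mem hx))

theorem I_mul_ofReal_smul (H : A) (t : ℝ) : (Complex.I * t) • H = t • (Complex.I • H) := by
  rw [mul_comm, mul_smul, Complex.coe_smul]

theorem hasDerivAt_exp_smul (H : A) (t : ℝ) :
    HasDerivAt (fun u : ℝ => NormedSpace.exp ((Complex.I * u) • H))
      (NormedSpace.exp ((Complex.I * t) • H) * (Complex.I • H)) t := by
  simp only [I_mul_ofReal_smul]
  exact hasDerivAt_exp_smul_const (Complex.I • H) t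

theorem hasDerivAt_exp_smul' (H : A) (t : ℝ) :
    HasDerivAt (fun u : ℝ => NormedSpace.exp ((Complex.I * u) • H))
      ((Complex.I • H) * NormedSpace.exp ((Complex.I * t) • H)) t := by
  simp only [I_mul_ofReal_smul]
  exact hasDerivAt_exp_smul_const' (Complex.I • H) t

theorem continuous_exp_smul (H : A) :
    Continuous (fun u : ℝ => NormedSpace.exp ((Complex.I * u) • H)) :=
  continuous_iff_continuousAt.mpr fun t => (hasDerivAt_exp_smul H t).continuousAt

theorem continuous_evolve (H B : A) : Continuous (fun u : ℝ => evolve H u B) := by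
  have h := continuous_exp_smul (-H)
  simp only [smul_neg] at h
  exact ((continuous_exp_smul H).mul continuous_const).mul h

theorem hasDerivAt_evolve_evolve (H G B : A) (t : ℝ) :
    HasDerivAt (fun u : ℝ => evolve G (-u) (evolve H u B))
      (evolve G (-t) (Complex.I • comm (H - G) (evolve H t B))) t := by
  have hH := hasDerivAt_exp_smul' H t
  have hH' := hasDerivAt_exp_smul (-H) t
  have hG' := hasDerivAt_exp_smul (-G) t
  have hG := hasDerivAt_exp_smul' G t
  simp only [smul_neg] at hH' hG'
  have h := (hG'.mul ((hH.mul_const B).mul hH')).mul hG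
  refine (h.congr_deriv ?_).congr_of_eventuallyEq (Eventually.of_forall fun u => ?_)
  · simp only [evolve, Complex.ofReal_neg, mul_neg, neg_smul, neg_neg, comm, smul_sub,
      sub_mul, mul_sub, smul_mul_assoc, mul_smul_comm, add_mul, mul_add, neg_mul, mul_assoc,
      Pi.mul_apply]
    abel
  · simp only [evolve, Complex.ofReal_neg, mul_neg, neg_smul, neg_neg, mul_assoc, Pi.mul_apply]

/-- Duhamel's formula as an inequality. -/
theorem norm_evolve_sub_evolve_le {H G : A} (hG : IsSelfAdjoint G) (B : A)
    {t : ℝ} (ht : 0 ≤ t) :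
    ‖evolve H t B - evolve G t B‖ ≤ ∫ u in (0 : ℝ)..t, ‖comm (H - G) (evolve H u B)‖ := by
  have hcont : Continuous fun u : ℝ => evolve G (-u) (Complex.I • comm (H - G) (evolve H u B)) := by
    have h1 := (continuous_exp_smul G).comp continuous_neg
    have h2 := (continuous_exp_smul (-G)).comp continuous_neg
    have h3 := continuous_evolve H B
    simp only [smul_neg] at h2
    refine (h1.mul (Continuous.const_smul ?_ _)).mul h2
    simp only [comm]
    fun_prop
  have hint := intervalIntegral.integral_eq_sub_of_hasDerivAt (a := 0) (b := t)
    (fun u _ => hasDerivAt_evolve_evolve H G B u) (hcont.intervalIntegrable _ _)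
  have hnorm : ‖evolve H t B - evolve G t B‖
      = ‖evolve G (-t) (evolve H t B) - evolve G (-0) (evolve H 0 B)‖ := by
    rw [← norm_evolve hG (-t) (evolve H t B - evolve G t B), evolve_sub, evolve_neg_evolve,
      neg_zero, evolve_zero_time, evolve_zero_time]
  rw [hnorm, ← hint]
  refine (intervalIntegral.norm_integral_le_integral_norm ht).trans (le_of_eq ?_)
  simp only [norm_evolve hG, norm_smul, Complex.norm_I, one_mul]

theorem continuous_norm_comm_evolve (H B C : A) :
    Continuous fun u : ℝ => ‖comm C (evolve H u B)‖ := by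
  have h := continuous_evolve H B
  simp only [comm]
  fun_prop

/-- If `H = K + N + R`, where `N` commutes with `K` and `B`, then the commutator of the evolution of
`B` with `C` is that of the evolution by `K`, up to the commutators of `C` with the evolution
of `R`. -/
theorem norm_comm_evolve_le {K N R B : A} (hK : IsSelfAdjoint K) (hN : IsSelfAdjoint N)
    (hR : IsSelfAdjoint R) (hKN : Commute K N) (hNB : Commute N B) (C : A) {t : ℝ} (ht : 0 ≤ t) :
    ‖comm (evolve (K + N + R) t B) C‖ ≤ ‖comm (evolve K t B) C‖
      + 2 * ‖B‖ * ∫ u in (0 : ℝ)..t, ‖comm (evolve (K + N + R) u R) C‖ := by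
  set H := K + N + R with hHdef
  have hG : IsSelfAdjoint (K + N) := hK.add hN
  have hH : IsSelfAdjoint H := hG.add hR
  have hd := norm_evolve_sub_evolve_le (H := -H) hG.neg C ht
  have e : -H - -(K + N) = -R := by rw [hHdef]; abel
  simp only [evolve_neg_generator, e] at hd
  simp only [neg_comm, norm_neg] at hd
  simp only [← norm_comm_evolve hH] at hd
  have h1 : comm B (evolve H (-t) C) = comm B (evolve (K + N) (-t) C)
      + comm B (evolve H (-t) C - evolve (K + N) (-t) C) := by
    rw [← comm_add]; congr 1; abel
  rw [norm_comm_evolve hH, h1]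
  refine (norm_add_le _ _).trans (add_le_add ?_ ?_)
  · rw [← norm_comm_evolve hG, evolve_add_of_commute hKN hNB]
  · exact (norm_comm_le _ _).trans (mul_le_mul_of_nonneg_left hd (by positivity))

end Evolution

section Locality

variable {d : ℕ}

theorem ann_mul_ann (x y : Site d) : ann x * ann y = -(ann y * ann x) :=
  Subtype.ext (eq_neg_of_add_eq_zero_left (annihilation_anticomm x y))

theorem ann_mul_star_ann {x y : Site d} (h : x ≠ y) :
    ann x * star (ann y) = -(star (ann y) * ann x) := by
  refine Subtype.ext (eq_neg_of_add_eq_zero_left ?_)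
  have := annihilation_star_anticomm x y
  rwa [if_neg h] at this

theorem gauge_pi_ann (y : Site d) : gauge Real.pi (ann y) = -ann y := by
  rw [gauge_ann, Complex.exp_neg, Complex.exp_pi_mul_I, inv_neg, inv_one, neg_one_smul]

theorem norm_starAlgEquiv (φ : CAR d ≃⋆ₐ[ℂ] CAR d) (B : CAR d) : ‖φ B‖ = ‖B‖ :=
  StarAlgEquiv.norm_map φ B

theorem continuous_starAlgEquiv (φ : CAR d ≃⋆ₐ[ℂ] CAR d) : Continuous φ :=
  AddMonoidHomClass.continuous_of_bound φ 1 fun B => by rw [norm_starAlgEquiv, one_mul]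

/-- Elements localized in `Z` commute with `a_y`, `y ∉ Z`, up to the parity automorphism. -/
theorem twisted_commute {Z : Finset (Site d)} {B : CAR d} (hB : B ∈ localAlgebra Z) {y : Site d}
    (hy : y ∉ Z) :
    (B * ann y = ann y * gauge Real.pi B ∧ gauge Real.pi B * ann y = ann y * B) ∧
      (B * star (ann y) = star (ann y) * gauge Real.pi B ∧
        gauge Real.pi B * star (ann y) = star (ann y) * B) := by
  induction hB using StarAlgebra.adjoin_induction with
  | mem b hb =>
    obtain ⟨x, hx, rfl⟩ := hb
    have hxy : x ≠ y := fun h => hy (h ▸ hx)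
    simp only [gauge_pi_ann, mul_neg, neg_mul, ann_mul_ann x y, ann_mul_star_ann hxy, neg_neg,
      and_self]
  | algebraMap r =>
    have h : gauge Real.pi (algebraMap ℂ (CAR d) r) = algebraMap ℂ (CAR d) r := by
      rw [Algebra.algebraMap_eq_smul_one, map_smul, map_one]
    rw [h]
    exact ⟨⟨Algebra.commutes _ _, Algebra.commutes _ _⟩, ⟨Algebra.commutes _ _,
      Algebra.commutes _ _⟩⟩
  | add b c _ _ hb hc =>
    simp only [map_add, add_mul, mul_add, hb.1.1, hb.1.2, hb.2.1, hb.2.2, hc.1.1, hc.1.2, hc.2.1,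
      hc.2.2, and_self]
  | mul b c _ _ hb hc =>
    simp only [map_mul, mul_assoc, hc.1.1, hc.1.2, hc.2.1, hc.2.2]
    simp only [← mul_assoc, hb.1.1, hb.1.2, hb.2.1, hb.2.2, and_self]
  | star b _ hb =>
    simp only [map_star]
    refine ⟨⟨?_, ?_⟩, ?_, ?_⟩
    · simpa using (congrArg star hb.2.2).symm
    · simpa using (congrArg star hb.2.1).symm
    · simpa using (congrArg star hb.1.2).symm
    · simpa using (congrArg star hb.1.1).symm

theorem commute_add_gauge {Z Y : Finset (Site d)} (hZY : Disjoint Z Y) {B C : CAR d}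
    (hB : B ∈ localAlgebra Z) (hC : C ∈ localAlgebra Y) :
    Commute (B + gauge Real.pi B) C := by
  have key : ∀ B ∈ localAlgebra Z, ∀ y ∈ Y,
      (B + gauge Real.pi B) * ann y = ann y * (B + gauge Real.pi B) := by
    intro B hB y hy
    have h := twisted_commute hB (Finset.disjoint_right.mp hZY hy)
    rw [add_mul, mul_add, h.1.1, h.1.2, add_comm]
  have hle : localAlgebra Y ≤ StarSubalgebra.centralizer ℂ {B + gauge Real.pi B} := by
    refine StarAlgebra.adjoin_le ?_
    rintro _ ⟨y, hy, rfl⟩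
    rw [SetLike.mem_coe, StarSubalgebra.mem_centralizer_iff]
    rintro _ rfl
    refine ⟨key B hB y hy, ?_⟩
    have := key (star B) (star_mem hB) y hy
    simpa [map_star] using this
  exact ((StarSubalgebra.mem_centralizer_iff ℂ).mp (hle hC) _ rfl).1

/-- The `C*`-algebra of the region `X`. -/
def localClosure (X : Finset (Site d)) : StarSubalgebra ℂ (CAR d) :=
  (localAlgebra X).topologicalClosure

theorem isClosed_localClosure (X : Finset (Site d)) : IsClosed (localClosure X : Set (CAR d)) :=
  StarSubalgebra.isClosed_topologicalClosure _

theorem localAlgebra_le_localClosure (X : Finset (Site d)) : localAlgebra X ≤ localClosure X :=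
  StarSubalgebra.le_topologicalClosure _

theorem localAlgebra_mono {X Y : Finset (Site d)} (h : X ⊆ Y) : localAlgebra X ≤ localAlgebra Y :=
  StarAlgebra.adjoin_mono (Set.image_mono (Finset.coe_subset.mpr h))

theorem localClosure_mono {X Y : Finset (Site d)} (h : X ⊆ Y) : localClosure X ≤ localClosure Y :=
  StarSubalgebra.topologicalClosure_mono (localAlgebra_mono h)

/-- Even elements commute with elements localized in a disjoint region. -/
theorem IsEven.commute {Z Y : Finset (Site d)} (hZY : Disjoint Z Y) {B C : CAR d}
    (hB : B ∈ localClosure Z) (hC : C ∈ localClosure Y) (he : IsEven B) : Commute B C := by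
  have hσ := continuous_starAlgEquiv (gauge (d := d) Real.pi)
  have h1 : ∀ C ∈ localAlgebra Y, Commute (B + gauge Real.pi B) C := by
    intro C hC
    have hcl : IsClosed {B : CAR d | (B + gauge Real.pi B) * C = C * (B + gauge Real.pi B)} :=
      isClosed_eq (by fun_prop) (by fun_prop)
    exact closure_minimal (fun B hB => (commute_add_gauge hZY hB hC).eq) hcl hB
  have h2 : Commute (B + gauge Real.pi B) C := by
    have hcl : IsClosed {C : CAR d | (B + gauge Real.pi B) * C = C * (B + gauge Real.pi B)} :=
      isClosed_eq (by fun_prop) (by fun_prop)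
    exact closure_minimal (fun C hC => (h1 C hC).eq) hcl hC
  have h3 : B + gauge Real.pi B = (2 : ℂ) • B := by rw [he, two_smul]
  rw [h3] at h2
  have h4 := h2.smul_left (2 : ℂ)⁻¹
  rwa [smul_smul, inv_mul_cancel₀ two_ne_zero, one_smul] at h4

/-- The `C*`-algebra of even elements. -/
def evenSubalgebra (d : ℕ) : StarSubalgebra ℂ (CAR d) where
  carrier := {B | IsEven B}
  mul_mem' := fun {B C} hB hC => by
    change gauge Real.pi (B * C) = B * C
    rw [map_mul, show gauge Real.pi B = B from hB, show gauge Real.pi C = C from hC]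
  add_mem' := fun {B C} hB hC => by
    change gauge Real.pi (B + C) = B + C
    rw [map_add, show gauge Real.pi B = B from hB, show gauge Real.pi C = C from hC]
  algebraMap_mem' := fun r => by
    change gauge Real.pi (algebraMap ℂ (CAR d) r) = algebraMap ℂ (CAR d) r
    rw [Algebra.algebraMap_eq_smul_one, map_smul, map_one]
  star_mem' := fun {B} hB => by
    change gauge Real.pi (star B) = star B
    rw [map_star, show gauge Real.pi B = B from hB]

theorem mem_evenSubalgebra {B : CAR d} : B ∈ evenSubalgebra d ↔ IsEven B := Iff.rfl

theorem isClosed_evenSubalgebra (d : ℕ) : IsClosed (evenSubalgebra d : Set (CAR d)) :=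
  isClosed_eq (continuous_starAlgEquiv _) continuous_id

theorem translation_mem_localAlgebra (v : Site d) {X : Finset (Site d)} {B : CAR d}
    (hB : B ∈ localAlgebra X) :
    translation v B ∈ localAlgebra (X.map (addRightEmbedding v)) := by
  have hle : localAlgebra X ≤ (localAlgebra (X.map (addRightEmbedding v))).comap
      (translation v).toStarAlgHom := by
    refine StarAlgebra.adjoin_le ?_
    rintro _ ⟨y, hy, rfl⟩
    change translation v (ann y) ∈ localAlgebra (X.map (addRightEmbedding v))
    rw [translation_ann]
    refine StarAlgebra.subset_adjoin ℂ _ ⟨y + v, ?_, rfl⟩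
    exact Finset.mem_coe.mpr (Finset.mem_map_of_mem (addRightEmbedding v) hy)
  exact hle hB

theorem gauge_translation (v : Site d) {X : Finset (Site d)} {B : CAR d}
    (hB : B ∈ localAlgebra X) :
    gauge Real.pi (translation v B) = translation v (gauge Real.pi B) := by
  induction hB using StarAlgebra.adjoin_induction with
  | mem b hb =>
    obtain ⟨x, -, rfl⟩ := hb
    rw [translation_ann, gauge_pi_ann, gauge_pi_ann, map_neg, translation_ann]
  | algebraMap r => simp only [Algebra.algebraMap_eq_smul_one, map_smul, map_one]
  | add b c _ _ hb hc => simp only [map_add, hb, hc]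
  | mul b c _ _ hb hc => simp only [map_mul, hb, hc]
  | star b _ hb => simp only [map_star, hb]

theorem IsEven.translation (v : Site d) {X : Finset (Site d)} {B : CAR d}
    (hB : B ∈ localAlgebra X) (he : IsEven B) : IsEven (translation v B) := by
  rw [IsEven, gauge_translation v hB, he]

/-- Local elements are dense. -/
theorem exists_local_approx (B : CAR d) {ε : ℝ} (hε : 0 < ε) :
    ∃ (X : Finset (Site d)) (C : CAR d), C ∈ localAlgebra X ∧ ‖B - C‖ < ε := by
  have hB : (B : Fock d →L[ℂ] Fock d) ∈ closure
      (StarAlgebra.adjoin ℂ (Set.range (annihilation (d := d))) : Set (Fock d →L[ℂ] Fock d)) := B.2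
  obtain ⟨c, hc, hdist⟩ := Metric.mem_closure_iff.mp hB ε hε
  have key : ∃ (X : Finset (Site d)) (C : CAR d), C ∈ localAlgebra X ∧
      (C : Fock d →L[ℂ] Fock d) = c := by
    clear hdist
    classical
    induction hc using StarAlgebra.adjoin_induction with
    | mem b hb =>
      obtain ⟨x, rfl⟩ := hb
      exact ⟨{x}, ann x, StarAlgebra.subset_adjoin ℂ _ ⟨x, by simp, rfl⟩, rfl⟩
    | algebraMap r => exact ⟨∅, algebraMap ℂ _ r, algebraMap_mem _ r, rfl⟩
    | add b c _ _ hb hc =>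
      obtain ⟨X, b, hb, rfl⟩ := hb
      obtain ⟨Y, c, hc, rfl⟩ := hc
      exact ⟨X ∪ Y, b + c, add_mem (localAlgebra_mono Finset.subset_union_left hb)
        (localAlgebra_mono Finset.subset_union_right hc), rfl⟩
    | mul b c _ _ hb hc =>
      obtain ⟨X, b, hb, rfl⟩ := hb
      obtain ⟨Y, c, hc, rfl⟩ := hc
      exact ⟨X ∪ Y, b * c, mul_mem (localAlgebra_mono Finset.subset_union_left hb)
        (localAlgebra_mono Finset.subset_union_right hc), rfl⟩
    | star b _ hb =>
      obtain ⟨X, b, hb, rfl⟩ := hb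
      exact ⟨X, star b, star_mem hb, rfl⟩
  obtain ⟨X, C, hC, rfl⟩ := key
  refine ⟨X, C, hC, ?_⟩
  rwa [dist_eq_norm] at hdist

end Locality

section LiebRobinson

/-- A quantum lattice system on the set of sites `σ`: a net of `C*`-algebras `loc X`, an interaction
and an on-site potential that commute with the algebras of disjoint regions. -/
structure LocalModel (A : Type*) [CStarAlgebra A] (σ : Type*) [DecidableEq σ] where
  /-- The algebra of a region. -/
  loc : Finset σ → StarSubalgebra ℂ A
  /-- The interaction. -/
  inter : Finset σ → A
  /-- The on-site potential. -/
  pot : σ → A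
  isClosed_loc : ∀ X, IsClosed (loc X : Set A)
  loc_mono : ∀ {X Y}, X ⊆ Y → loc X ≤ loc Y
  inter_mem : ∀ Z, inter Z ∈ loc Z
  pot_mem : ∀ x, pot x ∈ loc {x}
  inter_selfAdjoint : ∀ Z, IsSelfAdjoint (inter Z)
  pot_selfAdjoint : ∀ x, IsSelfAdjoint (pot x)
  inter_commute : ∀ {Z X}, Disjoint Z X → ∀ {B}, B ∈ loc X → Commute (inter Z) B
  pot_commute : ∀ {x X}, x ∉ X → ∀ {B}, B ∈ loc X → Commute (pot x) B

namespace LocalModel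

variable {A : Type*} [CStarAlgebra A] {σ : Type*} [DecidableEq σ]

/-- The Hamiltonian of a finite region. -/
def ham (M : LocalModel A σ) (Λ : Finset σ) : A :=
  ∑ Z ∈ Λ.powerset, M.inter Z + ∑ x ∈ Λ, M.pot x

/-- The time-reversed system. -/
def reverse (M : LocalModel A σ) : LocalModel A σ where
  loc := M.loc
  inter Z := -M.inter Z
  pot x := -M.pot x
  isClosed_loc := M.isClosed_loc
  loc_mono := M.loc_mono
  inter_mem Z := neg_mem (M.inter_mem Z)
  pot_mem x := neg_mem (M.pot_mem x)
  inter_selfAdjoint Z := (M.inter_selfAdjoint Z).neg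
  pot_selfAdjoint x := (M.pot_selfAdjoint x).neg
  inter_commute h _ hB := (M.inter_commute h hB).neg_left
  pot_commute h _ hB := (M.pot_commute h hB).neg_left

theorem ham_reverse (M : LocalModel A σ) (Λ : Finset σ) : M.reverse.ham Λ = -M.ham Λ := by
  simp [ham, reverse, add_comm]

theorem isSelfAdjoint_sum {ι : Type*} {s : Finset ι} {B : ι → A} (h : ∀ i, IsSelfAdjoint (B i)) :
    IsSelfAdjoint (∑ i ∈ s, B i) := by
  rw [IsSelfAdjoint, star_sum]
  exact Finset.sum_congr rfl fun i _ => (h i).star_eq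

variable (M : LocalModel A σ)

theorem isSelfAdjoint_ham (Λ : Finset σ) : IsSelfAdjoint (M.ham Λ) :=
  (isSelfAdjoint_sum M.inter_selfAdjoint).add (isSelfAdjoint_sum M.pot_selfAdjoint)

theorem sum_pot_mem {X Y : Finset σ} (h : X ⊆ Y) : ∑ x ∈ X, M.pot x ∈ M.loc Y :=
  sum_mem fun x hx => M.loc_mono (Finset.singleton_subset_iff.mpr (h hx)) (M.pot_mem x)

theorem ham_mem (Λ : Finset σ) : M.ham Λ ∈ M.loc Λ :=
  add_mem (sum_mem fun Z hZ => M.loc_mono (Finset.mem_powerset.mp hZ) (M.inter_mem Z))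
    (M.sum_pot_mem subset_rfl)

theorem evolve_ham_mem {Λ : Finset σ} {B : A} (hB : B ∈ M.loc Λ) (t : ℝ) :
    evolve (M.ham Λ) t B ∈ M.loc Λ :=
  evolve_mem (M.isClosed_loc Λ) (M.ham_mem Λ) hB t

theorem commute_sum_pot {X Y : Finset σ} (h : Disjoint Y X) {B : A} (hB : B ∈ M.loc X) :
    Commute (∑ x ∈ Y, M.pot x) B :=
  Commute.sum_left _ _ _ fun _ hx => M.pot_commute (Finset.disjoint_left.mp h hx) hB

/-- One step of the Lieb–Robinson iteration. -/
theorem norm_comm_evolve_ham_le {Λ X : Finset σ} (hX : X ⊆ Λ) {B : A} (hB : B ∈ M.loc X) {t : ℝ}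
    (ht : 0 ≤ t) : ∃ B' ∈ M.loc X, ‖B'‖ = ‖B‖ ∧ ∀ C,
      ‖comm (evolve (M.ham Λ) t B) C‖ ≤ ‖comm B' C‖ + 2 * ‖B‖ *
        ∫ u in (0 : ℝ)..t, ∑ W ∈ Λ.powerset with ¬Disjoint W X,
          ‖comm (evolve (M.ham Λ) u (M.inter W)) C‖ := by
  set K := ∑ x ∈ X, M.pot x with hKdef
  set N := ∑ x ∈ Λ \ X, M.pot x + ∑ W ∈ Λ.powerset with Disjoint W X, M.inter W with hNdef
  set R := ∑ W ∈ Λ.powerset with ¬Disjoint W X, M.inter W with hRdef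
  have hsum : M.ham Λ = K + N + R := by
    rw [ham, ← Finset.sum_sdiff hX, ← Finset.sum_filter_add_sum_filter_not Λ.powerset
      (fun W => Disjoint W X), hKdef, hNdef, hRdef]
    abel
  have hK : IsSelfAdjoint K := isSelfAdjoint_sum M.pot_selfAdjoint
  have hN : IsSelfAdjoint N :=
    (isSelfAdjoint_sum M.pot_selfAdjoint).add (isSelfAdjoint_sum M.inter_selfAdjoint)
  have hR : IsSelfAdjoint R := isSelfAdjoint_sum M.inter_selfAdjoint
  have hKmem : K ∈ M.loc X := M.sum_pot_mem subset_rfl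
  have hNcomm : ∀ {C : A}, C ∈ M.loc X → Commute N C := fun hC =>
    (M.commute_sum_pot Finset.sdiff_disjoint hC).add_left
      (Commute.sum_left _ _ _ fun _ hW => M.inter_commute (Finset.mem_filter.mp hW).2 hC)
  refine ⟨evolve K t B, evolve_mem (M.isClosed_loc X) hKmem hB t, norm_evolve hK t B, fun C => ?_⟩
  rw [hsum]
  refine (norm_comm_evolve_le hK hN hR (hNcomm hKmem).symm (hNcomm hB) C ht).trans ?_
  gcongr
  have hc : ∀ D : A, Continuous fun u : ℝ => ‖comm (evolve (K + N + R) u D) C‖ := by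
    intro D
    simp only [norm_comm_symm _ C]
    exact continuous_norm_comm_evolve _ _ _
  refine intervalIntegral.integral_mono_on ht ((hc R).intervalIntegrable _ _)
    ((continuous_finsetSum _ fun W _ => hc (M.inter W)).intervalIntegrable _ _) fun u _ => ?_
  conv_lhs => rw [hRdef, evolve_sum, sum_comm_left]
  exact norm_sum_le _ _

/-- Decay of an interaction, relative to a kernel `G` on the lattice. -/
structure Decay (G : σ → σ → ℝ) (α D : ℝ) : Prop where
  kernel_nonneg : ∀ x y, 0 ≤ G x y
  norm_nonneg : 0 ≤ α
  const_nonneg : 0 ≤ D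
  sum_inter_le : ∀ x y (𝒵 : Finset (Finset σ)), (∀ Z ∈ 𝒵, x ∈ Z ∧ y ∈ Z) →
    ∑ Z ∈ 𝒵, ‖M.inter Z‖ ≤ α * G x y
  conv_le : ∀ x y (Λ : Finset σ), ∑ w ∈ Λ, G x w * G w y ≤ D * G x y

variable {M} {G : σ → σ → ℝ} {α D : ℝ}

theorem Decay.reverse (h : M.Decay G α D) : M.reverse.Decay G α D where
  kernel_nonneg := h.kernel_nonneg
  norm_nonneg := h.norm_nonneg
  const_nonneg := h.const_nonneg
  sum_inter_le x y 𝒵 h𝒵 := by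
    simpa [LocalModel.reverse] using h.sum_inter_le x y 𝒵 h𝒵
  conv_le := h.conv_le

theorem sum_le_sum_of_not_disjoint {X : Finset σ} {𝒵 : Finset (Finset σ)}
    (h : ∀ Z ∈ 𝒵, ¬Disjoint Z X) {g : Finset σ → ℝ} (hg : ∀ Z, 0 ≤ g Z) :
    ∑ Z ∈ 𝒵, g Z ≤ ∑ x ∈ X, ∑ Z ∈ 𝒵 with x ∈ Z, g Z := by
  simp only [Finset.sum_filter]
  rw [Finset.sum_comm]
  refine Finset.sum_le_sum fun Z hZ => ?_
  obtain ⟨x, hxZ, hxX⟩ := Finset.not_disjoint_iff.mp (h Z hZ)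
  calc g Z = if x ∈ Z then g Z else 0 := by rw [if_pos hxZ]
    _ ≤ _ := Finset.single_le_sum (f := fun x => if x ∈ Z then g Z else 0)
      (fun y _ => by split_ifs; exacts [hg Z, le_rfl]) hxX

theorem Decay.sum_norm_inter_le (h : M.Decay G α D) {X S : Finset σ} {𝒵 : Finset (Finset σ)}
    (hX : ∀ Z ∈ 𝒵, ¬Disjoint Z X) (hS : ∀ Z ∈ 𝒵, ¬Disjoint Z S) :
    ∑ Z ∈ 𝒵, ‖M.inter Z‖ ≤ α * ∑ x ∈ X, ∑ y ∈ S, G x y := by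
  refine (sum_le_sum_of_not_disjoint hX fun Z => _root_.norm_nonneg _).trans ?_
  rw [Finset.mul_sum]
  refine Finset.sum_le_sum fun x _ => ?_
  refine (sum_le_sum_of_not_disjoint (X := S) (fun Z hZ => hS Z (Finset.mem_filter.mp hZ).1)
    fun Z => _root_.norm_nonneg _).trans ?_
  rw [Finset.mul_sum]
  refine Finset.sum_le_sum fun y _ => h.sum_inter_le x y _ fun Z hZ => ?_
  simp only [Finset.mem_filter] at hZ
  exact ⟨hZ.1.2, hZ.2⟩

theorem Decay.sum_norm_inter_mul_le (h : M.Decay G α D) {Λ X S : Finset σ}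
    {𝒵 : Finset (Finset σ)} (hΛ : ∀ Z ∈ 𝒵, Z ⊆ Λ) (hX : ∀ Z ∈ 𝒵, ¬Disjoint Z X) :
    ∑ Z ∈ 𝒵, ‖M.inter Z‖ * ∑ w ∈ Z, ∑ y ∈ S, G w y
      ≤ D * α * ∑ x ∈ X, ∑ y ∈ S, G x y := by
  have hG : ∀ w, 0 ≤ ∑ y ∈ S, G w y := fun w => Finset.sum_nonneg fun y _ => h.kernel_nonneg w y
  refine (sum_le_sum_of_not_disjoint hX fun Z => mul_nonneg (_root_.norm_nonneg _)
    (Finset.sum_nonneg fun w _ => hG w)).trans ?_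
  rw [Finset.mul_sum]
  refine Finset.sum_le_sum fun x _ => ?_
  have e : ∀ Z ∈ 𝒵.filter (x ∈ ·), ‖M.inter Z‖ * ∑ w ∈ Z, ∑ y ∈ S, G w y
      = ∑ w ∈ Λ, if w ∈ Z then ‖M.inter Z‖ * ∑ y ∈ S, G w y else 0 := by
    intro Z hZ
    rw [← Finset.sum_filter, Finset.mul_sum, Finset.filter_mem_eq_inter,
      Finset.inter_eq_right.mpr (hΛ Z (Finset.mem_filter.mp hZ).1)]
  rw [Finset.sum_congr rfl e, Finset.sum_comm]
  calc _ ≤ ∑ w ∈ Λ, α * G x w * ∑ y ∈ S, G w y := by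
        refine Finset.sum_le_sum fun w _ => ?_
        rw [← Finset.sum_filter, ← Finset.sum_mul]
        refine mul_le_mul_of_nonneg_right (h.sum_inter_le x w _ fun Z hZ => ?_) (hG w)
        simp only [Finset.mem_filter] at hZ
        exact ⟨hZ.1.2, hZ.2⟩
    _ = α * ∑ y ∈ S, ∑ w ∈ Λ, G x w * G w y := by
        rw [Finset.sum_comm, Finset.mul_sum]
        refine Finset.sum_congr rfl fun w _ => ?_
        rw [Finset.mul_sum, Finset.mul_sum]
        exact Finset.sum_congr rfl fun y _ => mul_assoc _ _ _
    _ ≤ α * ∑ y ∈ S, D * G x y := by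
        exact mul_le_mul_of_nonneg_left (Finset.sum_le_sum fun y _ => h.conv_le x y Λ)
          h.norm_nonneg
    _ = _ := by rw [← Finset.mul_sum]; ring

theorem integral_exp_add_pow (a b c : ℝ) (N : ℕ) (t : ℝ) :
    ∫ u in (0 : ℝ)..t, (b * a * Real.exp (a * u) + c * (u ^ N / N.factorial))
      = b * (Real.exp (a * t) - 1) + c * (t ^ (N + 1) / (N + 1).factorial) := by
  have hd : ∀ u ∈ Set.uIcc 0 t, HasDerivAt
      (fun u : ℝ => b * Real.exp (a * u) + c * (u ^ (N + 1) / (N + 1).factorial))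
      (b * a * Real.exp (a * u) + c * (u ^ N / N.factorial)) u := by
    intro u _
    have h1 := (((hasDerivAt_id u).const_mul a).exp).const_mul b
    have h2 := ((hasDerivAt_pow (N + 1) u).div_const ((N + 1).factorial : ℝ)).const_mul c
    refine (h1.add h2).congr_deriv ?_
    have hN : (N.factorial : ℝ) ≠ 0 := by positivity
    have hN' : ((N : ℝ) + 1) ≠ 0 := by positivity
    rw [Nat.factorial_succ]
    push_cast
    simp only [id, mul_one]
    field_simp
  rw [intervalIntegral.integral_eq_sub_of_hasDerivAt hd
    (Continuous.intervalIntegrable (by fun_prop) _ _)]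
  simp
  ring

theorem Decay.sum_norm_comm_le_add (h : M.Decay G α D) {Λ S : Finset σ} {𝒵 : Finset (Finset σ)}
    (h𝒵 : ∀ Z ∈ 𝒵, ¬Disjoint Z S) (N : ℕ) {X : Finset σ} (hX : X ⊆ Λ) {B : A}
    (hB : B ∈ M.loc X) {t : ℝ} (ht : 0 ≤ t) :
    ∑ Z ∈ 𝒵, ‖comm (evolve (M.ham Λ) t B) (M.inter Z)‖ ≤ ‖B‖ *
      (2 * α * (∑ x ∈ X, ∑ y ∈ S, G x y) * Real.exp (2 * D * α * t)
        + 2 * (∑ Z ∈ 𝒵, ‖M.inter Z‖) * (2 * ∑ W ∈ Λ.powerset, ‖M.inter W‖) ^ N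
          * (t ^ N / N.factorial)) := by
  have hH := M.isSelfAdjoint_ham Λ
  have hf : ∀ X : Finset σ, 0 ≤ ∑ x ∈ X, ∑ y ∈ S, G x y := fun X =>
    Finset.sum_nonneg fun x _ => Finset.sum_nonneg fun y _ => h.kernel_nonneg x y
  have hα := h.norm_nonneg
  have hD := h.const_nonneg
  induction N generalizing X B t with
  | zero =>
    have h1 : ∑ Z ∈ 𝒵, ‖comm (evolve (M.ham Λ) t B) (M.inter Z)‖
        ≤ ∑ Z ∈ 𝒵, 2 * ‖B‖ * ‖M.inter Z‖ :=
      Finset.sum_le_sum fun Z _ => by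
        simpa only [norm_evolve hH] using norm_comm_le (evolve (M.ham Λ) t B) (M.inter Z)
    rw [← Finset.mul_sum] at h1
    have h2 : 0 ≤ ‖B‖ * (2 * α * (∑ x ∈ X, ∑ y ∈ S, G x y) * Real.exp (2 * D * α * t)) := by
      have := hf X
      positivity
    simp only [pow_zero, Nat.factorial_zero, Nat.cast_one, div_one, mul_one]
    linarith
  | succ N ih =>
    obtain ⟨B', hB', hnorm, hstep⟩ := M.norm_comm_evolve_ham_le hX hB ht
    set c := 2 * ∑ W ∈ Λ.powerset, ‖M.inter W‖ with hc
    set m := 2 * ∑ Z ∈ 𝒵, ‖M.inter Z‖ with hm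
    set f := fun X : Finset σ => ∑ x ∈ X, ∑ y ∈ S, G x y with hfdef
    have hm0 : 0 ≤ m := by positivity
    have hc0 : 0 ≤ c := by positivity
    set ℛ := Λ.powerset.filter (fun W => ¬Disjoint W X) with hℛ
    have hstatic : ∑ Z ∈ 𝒵, ‖comm B' (M.inter Z)‖ ≤ ‖B‖ * (2 * α * f X) := by
      calc _ ≤ ∑ Z ∈ 𝒵 with ¬Disjoint Z X, 2 * ‖B‖ * ‖M.inter Z‖ := by
            rw [Finset.sum_filter]
            refine Finset.sum_le_sum fun Z _ => ?_
            split_ifs with hd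
            · rw [comm_eq_zero_of_commute (M.inter_commute hd hB').symm, norm_zero]
            · rw [← hnorm]
              exact norm_comm_le _ _
        _ ≤ 2 * ‖B‖ * (α * f X) := by
            rw [← Finset.mul_sum]
            refine mul_le_mul_of_nonneg_left (h.sum_norm_inter_le
              (fun Z hZ => (Finset.mem_filter.mp hZ).2)
              (fun Z hZ => h𝒵 Z (Finset.mem_filter.mp hZ).1)) (by positivity)
        _ = _ := by ring
    have hcont : ∀ C E : A, Continuous fun u : ℝ => ‖comm (evolve (M.ham Λ) u E) C‖ := by
      intro C E
      simp only [norm_comm_symm _ C]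
      exact continuous_norm_comm_evolve _ _ _
    have hint : ∑ Z ∈ 𝒵, ∫ u in (0 : ℝ)..t, ∑ W ∈ ℛ,
          ‖comm (evolve (M.ham Λ) u (M.inter W)) (M.inter Z)‖
        ≤ ∫ u in (0 : ℝ)..t, (α * f X * (2 * D * α) * Real.exp (2 * D * α * u)
          + m * c ^ N * (c / 2) * (u ^ N / N.factorial)) := by
      rw [← intervalIntegral.integral_finsetSum fun Z _ => Continuous.intervalIntegrable
        (continuous_finsetSum _ fun W _ => hcont (M.inter Z) (M.inter W)) _ _]
      refine intervalIntegral.integral_mono_on ht (Continuous.intervalIntegrable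
        (continuous_finsetSum _ fun Z _ => continuous_finsetSum _ fun W _ =>
          hcont (M.inter Z) (M.inter W)) _ _) (Continuous.intervalIntegrable (by fun_prop) _ _)
        fun u hu => ?_
      rw [Finset.sum_comm]
      calc _ ≤ ∑ W ∈ ℛ, ‖M.inter W‖ * (2 * α * f W * Real.exp (2 * D * α * u)
            + m * c ^ N * (u ^ N / N.factorial)) := by
            refine Finset.sum_le_sum fun W hW => ?_
            exact ih (Finset.mem_powerset.mp (Finset.mem_filter.mp hW).1) (M.inter_mem W) hu.1
        _ = 2 * α * Real.exp (2 * D * α * u) * ∑ W ∈ ℛ, ‖M.inter W‖ * f W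
            + (∑ W ∈ ℛ, ‖M.inter W‖) * (m * c ^ N * (u ^ N / N.factorial)) := by
            rw [Finset.mul_sum, Finset.sum_mul, ← Finset.sum_add_distrib]
            exact Finset.sum_congr rfl fun W _ => by ring
        _ ≤ 2 * α * Real.exp (2 * D * α * u) * (D * α * f X)
            + (c / 2) * (m * c ^ N * (u ^ N / N.factorial)) := by
            have hu0 := hu.1
            refine add_le_add (mul_le_mul_of_nonneg_left (h.sum_norm_inter_mul_le
              (Λ := Λ) (fun Z hZ => Finset.mem_powerset.mp (Finset.mem_filter.mp hZ).1)
              (fun Z hZ => (Finset.mem_filter.mp hZ).2)) (by positivity))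
              (mul_le_mul_of_nonneg_right ?_ (by positivity))
            rw [hc, mul_div_cancel_left₀ _ two_ne_zero]
            exact Finset.sum_le_sum_of_subset_of_nonneg (Finset.filter_subset _ _)
              fun W _ _ => _root_.norm_nonneg _
        _ = _ := by ring
    rw [integral_exp_add_pow] at hint
    calc _ ≤ ∑ Z ∈ 𝒵, (‖comm B' (M.inter Z)‖ + 2 * ‖B‖ * ∫ u in (0 : ℝ)..t, ∑ W ∈ ℛ,
          ‖comm (evolve (M.ham Λ) u (M.inter W)) (M.inter Z)‖) :=
          Finset.sum_le_sum fun Z _ => hstep _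
      _ ≤ ‖B‖ * (2 * α * f X) + 2 * ‖B‖ * (α * f X * (Real.exp (2 * D * α * t) - 1)
          + m * c ^ N * (c / 2) * (t ^ (N + 1) / (N + 1).factorial)) := by
          rw [Finset.sum_add_distrib, ← Finset.mul_sum]
          exact add_le_add hstatic (mul_le_mul_of_nonneg_left hint (by positivity))
      _ = _ := by
          rw [pow_succ c]
          ring

/-- The Lieb–Robinson bound, summed over the interaction terms that meet the region `S`. -/
theorem Decay.sum_norm_comm_le (h : M.Decay G α D) {Λ S : Finset σ} {𝒵 : Finset (Finset σ)}
    (h𝒵 : ∀ Z ∈ 𝒵, ¬Disjoint Z S) {X : Finset σ} (hX : X ⊆ Λ) {B : A}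
    (hB : B ∈ M.loc X) {t : ℝ} (ht : 0 ≤ t) :
    ∑ Z ∈ 𝒵, ‖comm (evolve (M.ham Λ) t B) (M.inter Z)‖ ≤ ‖B‖ *
      (2 * α * (∑ x ∈ X, ∑ y ∈ S, G x y) * Real.exp (2 * D * α * t)) := by
  set c := 2 * ∑ W ∈ Λ.powerset, ‖M.inter W‖ with hc
  have hlim := ((((FloorSemiring.tendsto_pow_div_factorial_atTop (c * t)).const_mul
    (2 * ∑ Z ∈ 𝒵, ‖M.inter Z‖)).const_add
      (2 * α * (∑ x ∈ X, ∑ y ∈ S, G x y) * Real.exp (2 * D * α * t))).const_mul ‖B‖)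
  rw [mul_zero, add_zero] at hlim
  refine ge_of_tendsto' hlim fun N => ?_
  refine (h.sum_norm_comm_le_add h𝒵 N hX hB ht).trans (le_of_eq ?_)
  rw [← hc, mul_pow]
  ring

theorem Decay.norm_evolve_sub_le_of_nonneg (h : M.Decay G α D) {X Λ Λ' : Finset σ} (hX : X ⊆ Λ)
    (hΛ : Λ ⊆ Λ') {B : A} (hB : B ∈ M.loc X) {t : ℝ} (ht : 0 ≤ t) :
    ‖evolve (M.ham Λ') t B - evolve (M.ham Λ) t B‖
      ≤ ‖B‖ * (2 * α * (t * Real.exp (2 * D * α * t))) * ∑ x ∈ X, ∑ y ∈ Λ' \ Λ, G x y := by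
  set N := ∑ x ∈ Λ' \ Λ, M.pot x with hNdef
  set 𝒵 := Λ'.powerset.filter (fun Z => ¬Disjoint Z (Λ' \ Λ)) with h𝒵def
  have hsets : Λ'.powerset.filter (fun Z => Disjoint Z (Λ' \ Λ)) = Λ.powerset := by
    ext Z
    simp only [Finset.mem_filter, Finset.mem_powerset]
    constructor
    · rintro ⟨h1, h2⟩ z hz
      by_contra hzΛ
      exact Finset.disjoint_left.mp h2 hz (Finset.mem_sdiff.mpr ⟨h1 hz, hzΛ⟩)
    · exact fun h1 => ⟨h1.trans hΛ, Finset.disjoint_of_subset_left h1 Finset.disjoint_sdiff⟩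
  have hdiff : M.ham Λ' - (M.ham Λ + N) = ∑ Z ∈ 𝒵, M.inter Z := by
    rw [ham, ham, ← Finset.sum_sdiff hΛ, ← hsets, ← Finset.sum_filter_add_sum_filter_not Λ'.powerset
      (fun W => Disjoint W (Λ' \ Λ))]
    abel
  have hdisj : Disjoint (Λ' \ Λ) Λ := Finset.sdiff_disjoint
  have hsmall : evolve (M.ham Λ + N) t B = evolve (M.ham Λ) t B :=
    evolve_add_of_commute (M.commute_sum_pot hdisj (M.ham_mem Λ)).symm
      (M.commute_sum_pot hdisj (M.loc_mono hX hB)) t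
  have hG : IsSelfAdjoint (M.ham Λ + N) :=
    (M.isSelfAdjoint_ham Λ).add (isSelfAdjoint_sum M.pot_selfAdjoint)
  have hα := h.norm_nonneg
  have hD := h.const_nonneg
  have hf : 0 ≤ ∑ x ∈ X, ∑ y ∈ Λ' \ Λ, G x y :=
    Finset.sum_nonneg fun x _ => Finset.sum_nonneg fun y _ => h.kernel_nonneg x y
  rw [← hsmall]
  refine (norm_evolve_sub_evolve_le hG B ht).trans ?_
  rw [hdiff]
  calc _ ≤ ∫ _u in (0 : ℝ)..t, ‖B‖ * (2 * α * (∑ x ∈ X, ∑ y ∈ Λ' \ Λ, G x y)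
        * Real.exp (2 * D * α * t)) := by
        refine intervalIntegral.integral_mono_on ht
          ((continuous_norm_comm_evolve _ _ _).intervalIntegrable _ _)
          (continuous_const.intervalIntegrable _ _) fun u hu => ?_
        have hb := h.sum_norm_comm_le (𝒵 := 𝒵) (S := Λ' \ Λ)
          (fun Z hZ => (Finset.mem_filter.mp hZ).2) (hX.trans hΛ) hB hu.1
        rw [sum_comm_left]
        refine (norm_sum_le _ _).trans ?_
        simp only [norm_comm_symm (M.inter _)]
        refine hb.trans ?_
        gcongr
        exact hu.2
    _ = _ := by
        rw [intervalIntegral.integral_const, sub_zero, smul_eq_mul]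
        ring

/-- The dependence of the evolution on the volume. -/
theorem Decay.norm_evolve_sub_le (h : M.Decay G α D) {X Λ Λ' : Finset σ} (hX : X ⊆ Λ)
    (hΛ : Λ ⊆ Λ') {B : A} (hB : B ∈ M.loc X) (t : ℝ) :
    ‖evolve (M.ham Λ') t B - evolve (M.ham Λ) t B‖
      ≤ ‖B‖ * (2 * α * (|t| * Real.exp (2 * D * α * |t|))) * ∑ x ∈ X, ∑ y ∈ Λ' \ Λ, G x y := by
  rcases le_total 0 t with ht | ht
  · rw [abs_of_nonneg ht]
    exact h.norm_evolve_sub_le_of_nonneg hX hΛ hB ht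
  · rw [abs_of_nonpos ht]
    have := h.reverse.norm_evolve_sub_le_of_nonneg hX hΛ (B := B) hB (neg_nonneg.mpr ht)
    simpa only [ham_reverse, evolve_neg_generator, neg_neg] using this

/-- The evolution of local elements converges in the infinite-volume limit. -/
theorem Decay.cauchySeq_evolve_of_mem (h : M.Decay G α D) (hG : ∀ x, Summable (G x))
    {X : Finset σ} {B : A} (hB : B ∈ M.loc X) (t : ℝ) :
    CauchySeq fun Λ : Finset σ => evolve (M.ham Λ) t B := by
  set c := ‖B‖ * (2 * α * (|t| * Real.exp (2 * D * α * |t|)))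
  have hc : 0 ≤ c := by
    have := h.norm_nonneg
    positivity
  have hsum : Summable fun y => c * ∑ x ∈ X, G x y :=
    (summable_sum fun x _ => hG x).mul_left c
  rw [Metric.cauchySeq_iff']
  intro ε hε
  obtain ⟨s, hs⟩ := summable_iff_vanishing.mp hsum _ (Metric.ball_mem_nhds 0 hε)
  refine ⟨s ∪ X, fun Λ hΛ => ?_⟩
  have h1 := h.norm_evolve_sub_le (Finset.subset_union_right (s₁ := s)) hΛ hB t
  have h2 := hs (Λ \ (s ∪ X)) (Finset.disjoint_of_subset_right Finset.subset_union_left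
    Finset.sdiff_disjoint)
  rw [mem_ball_zero_iff, Real.norm_eq_abs, ← Finset.mul_sum, Finset.sum_comm] at h2
  rw [dist_eq_norm]
  exact h1.trans_lt (lt_of_abs_lt h2)

theorem Decay.cauchySeq_evolve (h : M.Decay G α D) (hG : ∀ x, Summable (G x))
    (hdense : ∀ (B : A) (ε : ℝ), 0 < ε → ∃ X, ∃ C ∈ M.loc X, ‖B - C‖ < ε) (B : A) (t : ℝ) :
    CauchySeq fun Λ : Finset σ => evolve (M.ham Λ) t B := by
  rw [Metric.cauchySeq_iff']
  intro ε hε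
  obtain ⟨X, C, hC, hBC⟩ := hdense B (ε / 3) (by positivity)
  obtain ⟨s, hs⟩ := Metric.cauchySeq_iff'.mp (h.cauchySeq_evolve_of_mem hG hC t) (ε / 3)
    (by positivity)
  refine ⟨s, fun Λ hΛ => ?_⟩
  have h1 := hs Λ hΛ
  rw [dist_eq_norm] at h1 ⊢
  have h2 : ‖evolve (M.ham Λ) t (B - C)‖ < ε / 3 := by
    rwa [norm_evolve (M.isSelfAdjoint_ham Λ)]
  have h3 : ‖evolve (M.ham s) t (B - C)‖ < ε / 3 := by
    rwa [norm_evolve (M.isSelfAdjoint_ham s)]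
  have e : evolve (M.ham Λ) t B - evolve (M.ham s) t B = evolve (M.ham Λ) t (B - C)
      + (evolve (M.ham Λ) t C - evolve (M.ham s) t C) - evolve (M.ham s) t (B - C) := by
    rw [evolve_sub, evolve_sub]
    abel
  rw [e]
  calc _ ≤ ‖evolve (M.ham Λ) t (B - C)‖ + ‖evolve (M.ham Λ) t C - evolve (M.ham s) t C‖
        + ‖evolve (M.ham s) t (B - C)‖ :=
        (norm_sub_le _ _).trans (add_le_add_left (norm_add_le _ _) _)
    _ < ε := by linarith

end LocalModel

end LiebRobinson

section Dynamics

variable {d : ℕ}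

/-- The lattice fermion system with interaction `Ψ` and potential `V`. -/
def fermionModel (Ψ : Interaction d) (V : Potential d) : LocalModel (CAR d) (Site d) where
  loc := localClosure
  inter := Ψ.term
  pot := V.term
  isClosed_loc := isClosed_localClosure
  loc_mono h := localClosure_mono h
  inter_mem Z := localAlgebra_le_localClosure Z (Ψ.isLocal Z)
  pot_mem x := localAlgebra_le_localClosure {x} (V.isLocal x)
  inter_selfAdjoint := Ψ.isSelfAdjoint
  pot_selfAdjoint := V.isSelfAdjoint
  inter_commute {Z _} h _ hB :=
    (Ψ.isEven Z).commute h (localAlgebra_le_localClosure Z (Ψ.isLocal Z)) hB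
  pot_commute {x _} h _ hB := (V.isEven x).commute (Finset.disjoint_singleton_left.mpr h)
    (localAlgebra_le_localClosure {x} (V.isLocal x)) hB

theorem len_nonneg (x : Site d) : 0 ≤ len x := Real.sqrt_nonneg _

theorem sum_norm_term_le {F : ℝ → ℝ} (hF : IsDecayFunction d F) {Ψ : Interaction d}
    (hΨ : Ψ.eNormW F < ⊤) (x y : Site d) {𝒵 : Finset (Finset (Site d))}
    (h𝒵 : ∀ Z ∈ 𝒵, x ∈ Z ∧ y ∈ Z) :
    ∑ Z ∈ 𝒵, ‖Ψ.term Z‖ ≤ Ψ.normW F * F (len (x - y)) := by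
  have hpos := hF.pos _ (len_nonneg (x - y))
  rw [← div_le_iff₀ hpos, Finset.sum_div, Interaction.normW,
    ← ENNReal.ofReal_le_iff_le_toReal hΨ.ne,
    ENNReal.ofReal_sum_of_nonneg fun Z _ => by positivity]
  refine le_trans ?_ (le_iSup₂ (f := fun x y : Site d =>
    ∑' Λ : {Λ : Finset (Site d) // {x, y} ⊆ Λ}, ENNReal.ofReal (‖Ψ.term Λ‖ / F (len (x - y)))) x y)
  have hsub : ∀ Z ∈ 𝒵, {x, y} ⊆ Z := fun Z hZ => by
    rw [Finset.insert_subset_iff, Finset.singleton_subset_iff]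
    exact h𝒵 Z hZ
  refine le_trans (le_of_eq ?_) (ENNReal.sum_le_tsum (𝒵.subtype fun Z => {x, y} ⊆ Z))
  rw [Finset.sum_subtype_of_mem (fun Z => ENNReal.ofReal (‖Ψ.term Z‖ / F (len (x - y)))) hsub]

theorem sum_conv_le {F : ℝ → ℝ} (hF : IsDecayFunction d F) (x y : Site d) (Λ : Finset (Site d)) :
    ∑ w ∈ Λ, F (len (x - w)) * F (len (w - y)) ≤ convConst d F * F (len (x - y)) := by
  have hpos : ∀ x y : Site d, 0 < F (len (x - y)) := fun x y => hF.pos _ (len_nonneg (x - y))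
  rw [← div_le_iff₀ (hpos x y), Finset.sum_div, convConst,
    ← ENNReal.ofReal_le_iff_le_toReal hF.conv_lt_top.ne,
    ENNReal.ofReal_sum_of_nonneg fun w _ =>
      div_nonneg (mul_nonneg (hpos x w).le (hpos w y).le) (hpos x y).le]
  exact (ENNReal.sum_le_tsum Λ).trans (le_iSup₂ (f := fun x y : Site d =>
    ∑' z : Site d, ENNReal.ofReal (F (len (x - z)) * F (len (z - y)) / F (len (x - y)))) x y)

theorem convConst_nonneg (d : ℕ) (F : ℝ → ℝ) : 0 ≤ convConst d F := ENNReal.toReal_nonneg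

theorem normW_nonneg (F : ℝ → ℝ) (Ψ : Interaction d) : 0 ≤ Ψ.normW F := ENNReal.toReal_nonneg

theorem fermionModel_decay {F : ℝ → ℝ} (hF : IsDecayFunction d F) {Ψ : Interaction d}
    (hΨ : Ψ.eNormW F < ⊤) (V : Potential d) :
    (fermionModel Ψ V).Decay (fun x y => F (len (x - y))) (Ψ.normW F) (convConst d F) where
  kernel_nonneg x y := (hF.pos _ (len_nonneg (x - y))).le
  norm_nonneg := normW_nonneg F Ψ
  const_nonneg := convConst_nonneg d F
  sum_inter_le x y _ h𝒵 := sum_norm_term_le hF hΨ x y h𝒵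
  conv_le x y Λ := sum_conv_le hF x y Λ

theorem summable_kernel {F : ℝ → ℝ} (hF : IsDecayFunction d F) (x : Site d) :
    Summable fun y : Site d => F (len (x - y)) :=
  (Equiv.subLeft x).summable_iff.mpr hF.summable

theorem box_mono : Monotone (box d) := fun _ _ h _ hx =>
  mem_box.mpr fun i => (mem_box.mp hx i).trans h

theorem exists_mem_box (x : Site d) : ∃ n : ℕ, x ∈ box d n := by
  obtain ⟨n, hn⟩ := exists_nat_ge (∑ i, |(x i : ℝ)|)
  exact ⟨n, mem_box.mpr fun i => (Finset.single_le_sum (f := fun i => |(x i : ℝ)|)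
    (fun i _ => abs_nonneg _) (Finset.mem_univ i)).trans hn⟩

theorem tendsto_box : Tendsto (box d) atTop atTop :=
  tendsto_atTop_finset_of_monotone box_mono fun x =>
    let ⟨n, hn⟩ := exists_mem_box x
    ⟨n, hn⟩

theorem shiftedBox_mono (x : Site d) : Monotone fun n : ℕ => shiftedBox n x := fun _ _ h =>
  Finset.map_subset_map.mpr (box_mono (Nat.cast_le.mpr h))

theorem tendsto_shiftedBox (x : Site d) : Tendsto (fun n : ℕ => shiftedBox n x) atTop atTop := by
  refine tendsto_atTop_finset_of_monotone (shiftedBox_mono x) fun y => ?_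
  obtain ⟨n, hn⟩ := exists_mem_box (y - x)
  exact ⟨n, Finset.mem_map.mpr ⟨y - x, hn, sub_add_cancel y x⟩⟩

theorem cauchySeq_evolve {F : ℝ → ℝ} (hF : IsDecayFunction d F) {Ψ : Interaction d}
    (hΨ : Ψ.eNormW F < ⊤) (V : Potential d) (t : ℝ) (B : CAR d) :
    CauchySeq fun Λ : Finset (Site d) => evolve ((fermionModel Ψ V).ham Λ) t B :=
  (fermionModel_decay hF hΨ V).cauchySeq_evolve (summable_kernel hF)
    (fun B ε hε => by
      obtain ⟨X, C, hC, h⟩ := exists_local_approx B hε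
      exact ⟨X, C, localAlgebra_le_localClosure X hC, h⟩) B t

theorem tendsto_evolve_dynamics {F : ℝ → ℝ} (hF : IsDecayFunction d F) {Ψ : Interaction d}
    (hΨ : Ψ.eNormW F < ⊤) (V : Potential d) (t : ℝ) (B : CAR d) :
    Tendsto (fun Λ : Finset (Site d) => evolve ((fermionModel Ψ V).ham Λ) t B) atTop
      (𝓝 (dynamics Ψ V t B)) := by
  obtain ⟨C, hC⟩ := cauchySeq_tendsto_of_complete (cauchySeq_evolve hF hΨ V t B)
  have h : dynamics Ψ V t B = C := Tendsto.limUnder_eq (hC.comp tendsto_box)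
  rwa [h]

theorem tendsto_finiteDynamics {F : ℝ → ℝ} (hF : IsDecayFunction d F) {Ψ : Interaction d}
    (hΨ : Ψ.eNormW F < ⊤) (V : Potential d) (t : ℝ) (B : CAR d) :
    Tendsto (fun L : ℝ => finiteDynamics Ψ V L t B) atTop (𝓝 (dynamics Ψ V t B)) :=
  (tendsto_evolve_dynamics hF hΨ V t B).comp tendsto_box

theorem isEven_evolve (Ψ : Interaction d) (V : Potential d) (Λ : Finset (Site d)) (t : ℝ)
    {B : CAR d} (hB : IsEven B) : IsEven (evolve ((fermionModel Ψ V).ham Λ) t B) := by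
  have hH : (fermionModel Ψ V).ham Λ ∈ evenSubalgebra d :=
    add_mem (sum_mem fun Z _ => Ψ.isEven Z) (sum_mem fun x _ => V.isEven x)
  exact evolve_mem (isClosed_evenSubalgebra d) hH hB t

/-- The dynamics of `B` in the box `Λ_m + x` for `n = m`, and for `n > m` the difference of the
dynamics of `B` in the boxes `Λ_n + x` and `Λ_{n-1} + x`. -/
def layer (Ψ : Interaction d) (V : Potential d) (t : ℝ) (x : Site d) (m : ℕ) (B : CAR d) (n : ℕ) :
    CAR d :=
  if n = m then evolve ((fermionModel Ψ V).ham (shiftedBox m x)) t B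
  else evolve ((fermionModel Ψ V).ham (shiftedBox n x)) t B
    - evolve ((fermionModel Ψ V).ham (shiftedBox (n - 1) x)) t B

theorem sum_layer (Ψ : Interaction d) (V : Potential d) (t : ℝ) (x : Site d) (m : ℕ) (B : CAR d)
    {N : ℕ} (hN : m ≤ N) :
    ∑ n ∈ Finset.Icc m N, layer Ψ V t x m B n
      = evolve ((fermionModel Ψ V).ham (shiftedBox N x)) t B := by
  induction N, hN using Nat.le_induction with
  | base => simp [layer]
  | succ N hN ih =>
    rw [← Finset.insert_Icc_right_eq_Icc_add_one (by omega), Finset.sum_insert (by simp), ih, layer,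
      if_neg (by omega), Nat.add_sub_cancel, sub_add_cancel]

theorem isEven_layer (Ψ : Interaction d) (V : Potential d) (t : ℝ) (x : Site d) (m : ℕ) {B : CAR d}
    (hB : IsEven B) (n : ℕ) : IsEven (layer Ψ V t x m B n) := by
  unfold layer
  split_ifs
  · exact isEven_evolve Ψ V _ t hB
  · exact mem_evenSubalgebra.mp (sub_mem (mem_evenSubalgebra.mpr (isEven_evolve Ψ V _ t hB))
      (mem_evenSubalgebra.mpr (isEven_evolve Ψ V _ t hB)))

theorem layer_mem (Ψ : Interaction d) (V : Potential d) (t : ℝ) {x : Site d} {m : ℕ} {B : CAR d}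
    (hB : B ∈ localAlgebra (shiftedBox m x)) {n : ℕ} (hn : m ≤ n) :
    layer Ψ V t x m B n ∈ localClosure (shiftedBox n x) := by
  have hB' : ∀ n, m ≤ n → B ∈ localClosure (shiftedBox n x) := fun n hn =>
    localAlgebra_le_localClosure _ (localAlgebra_mono (shiftedBox_mono x hn) hB)
  unfold layer
  split_ifs with h
  · subst h
    exact (fermionModel Ψ V).evolve_ham_mem (hB' _ le_rfl) t
  · exact sub_mem ((fermionModel Ψ V).evolve_ham_mem (hB' _ hn) t)
      (localClosure_mono (shiftedBox_mono x (Nat.sub_le n 1))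
        ((fermionModel Ψ V).evolve_ham_mem (hB' _ (by omega)) t))

/-- The sum of `F(|z - y|)` over `z ∈ Λ_m` and `y ∈ Λ_n \ Λ_{n-1}`. -/
def shellSum (d : ℕ) (F : ℝ → ℝ) (m n : ℕ) : ℝ :=
  ∑ z ∈ box d m, ∑ y ∈ box d n \ box d ((n : ℝ) - 1), F (len (z - y))

theorem shellSum_nonneg {F : ℝ → ℝ} (hF : IsDecayFunction d F) (m n : ℕ) :
    0 ≤ shellSum d F m n :=
  Finset.sum_nonneg fun z _ => Finset.sum_nonneg fun y _ => (hF.pos _ (len_nonneg (z - y))).le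

/-- The norm of the `n`-th layer of the dynamics, relative to the norm of the observable. -/
def layerWeight (d : ℕ) (F : ℝ → ℝ) (α t : ℝ) (m n : ℕ) : ℝ :=
  if n = m then 1
  else 2 * α * (|t| * Real.exp (4 * convConst d F * α * |t|)) * shellSum d F m n

theorem layerWeight_nonneg {F : ℝ → ℝ} (hF : IsDecayFunction d F) {α : ℝ} (hα : 0 ≤ α) (t : ℝ)
    (m n : ℕ) : 0 ≤ layerWeight d F α t m n := by
  unfold layerWeight
  have := shellSum_nonneg hF m n
  split_ifs <;> positivity

theorem norm_layer_le {F : ℝ → ℝ} (hF : IsDecayFunction d F) {Ψ : Interaction d}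
    (hΨ : Ψ.eNormW F < ⊤) (V : Potential d) (t : ℝ) {x : Site d} {m : ℕ} {B : CAR d}
    (hB : B ∈ localAlgebra (shiftedBox m x)) {n : ℕ} (hn : m ≤ n) :
    ‖layer Ψ V t x m B n‖ ≤ ‖B‖ * layerWeight d F (Ψ.normW F) t m n := by
  unfold layer layerWeight
  split_ifs with h
  · rw [norm_evolve ((fermionModel Ψ V).isSelfAdjoint_ham _), mul_one]
  · have hb := (fermionModel_decay hF hΨ V).norm_evolve_sub_le
      (shiftedBox_mono x (show m ≤ n - 1 by omega)) (shiftedBox_mono x (Nat.sub_le n 1))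
      (localAlgebra_le_localClosure _ hB) t
    have e : ∑ z ∈ shiftedBox m x, ∑ y ∈ shiftedBox n x \ shiftedBox (n - 1) x, F (len (z - y))
        = shellSum d F m n := by
      have hsd : shiftedBox n x \ shiftedBox (n - 1) x
          = (box d n \ box d ((n : ℝ) - 1)).map (addRightEmbedding x) := by
        rw [shiftedBox, shiftedBox, Nat.cast_sub (by omega), Nat.cast_one]
        simp only [Finset.map_eq_image]
        exact (Finset.image_sdiff _ _ (addRightEmbedding x).injective).symm
      rw [hsd, shiftedBox, Finset.sum_map]
      simp [shellSum]
    have hα := normW_nonneg F Ψ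
    have hD := convConst_nonneg d F
    have hs := shellSum_nonneg hF m n
    refine hb.trans ?_
    simp only [e]
    rw [mul_assoc]
    gcongr
    norm_num

end Dynamics

section Trees

theorem mem_trees_of_parents {p : ℕ → ℕ} {k : ℕ} (hp : ∀ j, 1 ≤ j → j ≤ k → p j < j) :
    (Finset.Icc 1 k).image (fun j => s(p j, j)) ∈ trees k := by
  induction k with
  | zero => simp [trees]
  | succ k ih =>
    rw [trees, Finset.mem_image]
    refine ⟨(p (k + 1), (Finset.Icc 1 k).image fun j => s(p j, j)),
      Finset.mem_product.mpr ⟨Finset.mem_range.mpr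
      (hp (k + 1) (by omega) le_rfl), ih fun j h1 h2 => hp j h1 (by omega)⟩, ?_⟩
    rw [← Finset.insert_Icc_right_eq_Icc_add_one (by omega), Finset.image_insert]

theorem parent_image {p : ℕ → ℕ} {k : ℕ} (hp : ∀ j, 1 ≤ j → j ≤ k → p j < j) {j : ℕ} (h1 : 1 ≤ j)
    (hk : j ≤ k) : parent ((Finset.Icc 1 k).image fun j => s(p j, j)) j = p j := by
  have e : {i | i < j ∧ s(i, j) ∈ (Finset.Icc 1 k).image fun j => s(p j, j)} = {p j} := by
    ext i
    simp only [Set.mem_ofPred_eq, Finset.mem_image, Finset.mem_Icc, Sym2.eq_iff,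
      Set.mem_singleton_iff]
    constructor
    · rintro ⟨hij, j', ⟨h1', hk'⟩, ⟨h, rfl⟩ | ⟨h, rfl⟩⟩
      · exact h.symm
      · have := hp j' h1' hk'
        omega
    · rintro rfl
      exact ⟨hp j h1 hk, j, ⟨h1, hk⟩, Or.inl ⟨rfl, rfl⟩⟩
  rw [parent, e, csInf_singleton]

variable {d : ℕ}

theorem overlap_nonneg (k : ℕ) (T : Finset (Sym2 ℕ)) (n : ℕ → ℕ) (x : ℕ → Site d) :
    0 ≤ overlap k T n x :=
  Finset.prod_nonneg fun j _ => by split_ifs <;> norm_num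

theorem overlap_le_one (k : ℕ) (T : Finset (Sym2 ℕ)) (n : ℕ → ℕ) (x : ℕ → Site d) :
    overlap k T n x ≤ 1 :=
  Finset.prod_le_one (fun j _ => by split_ifs <;> norm_num) fun j _ => by split_ifs <;> norm_num

theorem one_le_sum_overlap {k : ℕ} {n : ℕ → ℕ} {x : ℕ → Site d}
    (h : ∀ j, 1 ≤ j → j ≤ k → ∃ i < j,
      (shiftedBox (n j) (x j) ∩ shiftedBox (n i) (x i)).Nonempty) :
    1 ≤ ∑ T ∈ trees k, overlap k T n x := by
  choose! p hp hov using h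
  refine le_trans (le_of_eq ?_) (Finset.single_le_sum
    (fun T _ => overlap_nonneg k T n x) (mem_trees_of_parents hp))
  refine (Finset.prod_eq_one fun j hj => ?_).symm
  obtain ⟨h1, hk⟩ := Finset.mem_Icc.mp hj
  rw [parent_image hp h1 hk, if_pos (hov j h1 hk)]

end Trees

section MultiCommutators

variable {d : ℕ}

theorem multiCommutator_congr {A : Type*} [Ring A] {B C : ℕ → A} {k : ℕ}
    (h : ∀ j ≤ k, B j = C j) : multiCommutator B k = multiCommutator C k := by
  induction k with
  | zero => exact h 0 le_rfl
  | succ k ih =>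
    rw [multiCommutator, multiCommutator, ih fun j hj => h j (by omega), h (k + 1) le_rfl]

theorem tendsto_multiCommutator {A : Type*} [NormedRing A] {B : ℕ → ℕ → A} {C : ℕ → A} {k : ℕ}
    (h : ∀ j ≤ k, Tendsto (fun N => B N j) atTop (𝓝 (C j))) :
    Tendsto (fun N => multiCommutator (B N) k) atTop (𝓝 (multiCommutator C k)) := by
  induction k with
  | zero => exact h 0 le_rfl
  | succ k ih =>
    have h1 := ih fun j hj => h j (by omega)
    have h2 := h (k + 1) le_rfl
    exact (h2.mul h1).sub (h1.mul h2)

theorem norm_multiCommutator_le {A : Type*} [NormedRing A] (B : ℕ → A) (k : ℕ) :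
    ‖multiCommutator B k‖ ≤ 2 ^ k * ∏ j ∈ Finset.range (k + 1), ‖B j‖ := by
  induction k with
  | zero => simp [multiCommutator]
  | succ k ih =>
    rw [multiCommutator, Finset.prod_range_succ]
    calc _ ≤ ‖B (k + 1)‖ * ‖multiCommutator B k‖ + ‖multiCommutator B k‖ * ‖B (k + 1)‖ :=
          (norm_sub_le _ _).trans (add_le_add (norm_mul_le _ _) (norm_mul_le _ _))
      _ = 2 * ‖multiCommutator B k‖ * ‖B (k + 1)‖ := by ring
      _ ≤ 2 * (2 ^ k * ∏ j ∈ Finset.range (k + 1), ‖B j‖) * ‖B (k + 1)‖ := by gcongr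
      _ = _ := by ring

theorem multiCommutator_eq_zero {A : Type*} [Ring A] {B : ℕ → A} {j k : ℕ} (hjk : j ≤ k)
    (h : multiCommutator B j = 0) : multiCommutator B k = 0 := by
  induction k, hjk using Nat.le_induction with
  | base => exact h
  | succ k _ ih => rw [multiCommutator, ih, mul_zero, zero_mul, sub_zero]

theorem multiCommutator_mem {X : ℕ → Finset (Site d)} {B : ℕ → CAR d} {k : ℕ}
    (hB : ∀ j ≤ k, B j ∈ localClosure (X j)) :
    multiCommutator B k ∈ localClosure ((Finset.range (k + 1)).biUnion X) := by
  induction k with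
  | zero => simpa [multiCommutator] using hB 0 le_rfl
  | succ k ih =>
    have h1 : multiCommutator B k ∈ localClosure ((Finset.range (k + 1 + 1)).biUnion X) :=
      localClosure_mono (Finset.biUnion_subset_biUnion_of_subset_left _
        (Finset.range_mono (Nat.le_succ _))) (ih fun j hj => hB j (by omega))
    have h2 : B (k + 1) ∈ localClosure ((Finset.range (k + 1 + 1)).biUnion X) :=
      localClosure_mono (Finset.subset_biUnion_of_mem X (by simp)) (hB (k + 1) le_rfl)
    exact sub_mem (mul_mem h2 h1) (mul_mem h1 h2)

/-- The multi-commutator of local elements vanishes unless their supports overlap along a tree. -/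
theorem norm_multiCommutator_le_overlap {k : ℕ} {n : ℕ → ℕ} {x : ℕ → Site d} {B : ℕ → CAR d}
    (hB : ∀ j ≤ k, B j ∈ localClosure (shiftedBox (n j) (x j)))
    (he : ∀ j, 1 ≤ j → j ≤ k → IsEven (B j)) :
    ‖multiCommutator B k‖ ≤ 2 ^ k * (∏ j ∈ Finset.range (k + 1), ‖B j‖) *
      ∑ T ∈ trees k, overlap k T n x := by
  have hpos : 0 ≤ 2 ^ k * ∏ j ∈ Finset.range (k + 1), ‖B j‖ := by positivity
  by_cases h : ∀ j, 1 ≤ j → j ≤ k → ∃ i < j,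
      (shiftedBox (n j) (x j) ∩ shiftedBox (n i) (x i)).Nonempty
  · exact (norm_multiCommutator_le B k).trans (le_mul_of_one_le_right hpos (one_le_sum_overlap h))
  · push Not at h
    obtain ⟨j, h1, hk, hj⟩ := h
    obtain ⟨j, rfl⟩ : ∃ i, j = i + 1 := ⟨j - 1, by omega⟩
    have hdisj : Disjoint (shiftedBox (n (j + 1)) (x (j + 1)))
        ((Finset.range (j + 1)).biUnion fun i => shiftedBox (n i) (x i)) := by
      rw [Finset.disjoint_biUnion_right]
      intro i hi
      exact Finset.disjoint_iff_inter_eq_empty.mpr (hj i (Finset.mem_range.mp hi))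
    have hc : Commute (B (j + 1)) (multiCommutator B j) :=
      (he (j + 1) h1 hk).commute hdisj (hB (j + 1) hk)
        (multiCommutator_mem fun i hi => hB i (by omega))
    have h0 : multiCommutator B (j + 1) = 0 := by
      rw [multiCommutator, hc.eq, sub_self]
    rw [multiCommutator_eq_zero hk h0, norm_zero]
    exact mul_nonneg hpos (Finset.sum_nonneg fun T _ => overlap_nonneg k T n x)

open Classical in
/-- The functions `ν` with `ν j ∈ S j` for `1 ≤ j ≤ k` and `ν j = m j` for all other `j`. -/
def choices (m : ℕ → ℕ) (S : ℕ → Finset ℕ) : ℕ → Finset (ℕ → ℕ)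
  | 0 => {m}
  | k + 1 => (S (k + 1) ×ˢ choices m S k).image fun p => Function.update p.2 (k + 1) p.1

theorem of_mem_choices {m : ℕ → ℕ} {S : ℕ → Finset ℕ} {k : ℕ} {ν : ℕ → ℕ}
    (h : ν ∈ choices m S k) :
    (∀ j, 1 ≤ j → j ≤ k → ν j ∈ S j) ∧ ν 0 = m 0 ∧ ∀ j, k < j → ν j = m j := by
  classical
  induction k generalizing ν with
  | zero =>
    rw [choices, Finset.mem_singleton] at h
    subst h
    exact ⟨fun j h1 h2 => by omega, rfl, fun _ _ => rfl⟩
  | succ k ih =>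
    rw [choices, Finset.mem_image] at h
    obtain ⟨⟨n, μ⟩, hp, rfl⟩ := h
    obtain ⟨hn, hμ⟩ := Finset.mem_product.mp hp
    obtain ⟨h1, h2, h3⟩ := ih hμ
    refine ⟨fun j hj1 hjk => ?_, ?_, fun j hj => ?_⟩
    · rcases eq_or_ne j (k + 1) with rfl | hne
      · simpa using hn
      · rw [Function.update_of_ne hne]
        exact h1 j hj1 (by omega)
    · rwa [Function.update_of_ne (by omega)]
    · rw [Function.update_of_ne (by omega)]
      exact h3 j (by omega)

theorem sum_choices_succ {A : Type*} [AddCommMonoid A] (m : ℕ → ℕ) (S : ℕ → Finset ℕ) (k : ℕ)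
    (f : (ℕ → ℕ) → A) :
    ∑ ν ∈ choices m S (k + 1), f ν
      = ∑ n ∈ S (k + 1), ∑ ν ∈ choices m S k, f (Function.update ν (k + 1) n) := by
  classical
  rw [choices, Finset.sum_image, Finset.sum_product]
  rintro ⟨n, μ⟩ h ⟨n', μ'⟩ h' he
  have hμ := (of_mem_choices (Finset.mem_product.mp h).2).2.2 (k + 1) (by omega)
  have hμ' := (of_mem_choices (Finset.mem_product.mp h').2).2.2 (k + 1) (by omega)
  have hn : n = n' := by simpa using congrFun he (k + 1)
  refine Prod.ext hn (funext fun j => ?_)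
  rcases eq_or_ne j (k + 1) with rfl | hne
  · exact hμ.trans hμ'.symm
  · simpa [Function.update_of_ne hne] using congrFun he j

/-- Multilinearity of the multi-commutator. -/
theorem multiCommutator_sum {A : Type*} [Ring A] (m : ℕ → ℕ) (S : ℕ → Finset ℕ) (b : ℕ → ℕ → A)
    (k : ℕ) :
    multiCommutator (fun j => if j = 0 then b 0 (m 0) else ∑ n ∈ S j, b j n) k
      = ∑ ν ∈ choices m S k, multiCommutator (fun j => b j (ν j)) k := by
  induction k with
  | zero => simp [multiCommutator, choices]
  | succ k ih =>
    have hupd : ∀ n (ν : ℕ → ℕ),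
        multiCommutator (fun j => b j (Function.update ν (k + 1) n j)) (k + 1)
          = b (k + 1) n * multiCommutator (fun j => b j (ν j)) k
            - multiCommutator (fun j => b j (ν j)) k * b (k + 1) n := by
      intro n ν
      have hc : multiCommutator (fun j => b j (Function.update ν (k + 1) n j)) k
          = multiCommutator (fun j => b j (ν j)) k :=
        multiCommutator_congr fun j hj => by rw [Function.update_of_ne (by omega)]
      rw [multiCommutator, hc, Function.update_self]
    rw [sum_choices_succ]
    simp only [hupd]
    rw [multiCommutator, ih, if_neg (by omega)]
    simp only [Finset.sum_sub_distrib, ← Finset.mul_sum, ← Finset.sum_mul]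

end MultiCommutators

section Remainder

variable {d : ℕ}

theorem sum_shellSum_le {F : ℝ → ℝ} (hF : IsDecayFunction d F) (m : ℕ) (v : Finset ℕ) :
    ∑ n ∈ v, shellSum d F m n ≤ ∑ z ∈ box d m, ∑' y : Site d, F (len (z - y)) := by
  simp only [shellSum]
  rw [Finset.sum_comm]
  refine Finset.sum_le_sum fun z _ => ?_
  have hdisj : (v : Set ℕ).PairwiseDisjoint fun n : ℕ => box d n \ box d ((n : ℝ) - 1) := by
    have key : ∀ n n' : ℕ, n < n' → Disjoint (box d n \ box d ((n : ℝ) - 1))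
        (box d n' \ box d ((n' : ℝ) - 1)) := by
      intro n n' h
      have h' : (n : ℝ) ≤ (n' : ℝ) - 1 := by
        have : ((n + 1 : ℕ) : ℝ) ≤ n' := Nat.cast_le.mpr h
        push_cast at this
        linarith
      exact Finset.disjoint_of_subset_left (Finset.sdiff_subset.trans (box_mono h'))
        Finset.disjoint_sdiff
    intro n _ n' _ hne
    rcases lt_or_gt_of_ne hne with h | h
    · exact key n n' h
    · exact (key n' n h).symm
  rw [← Finset.sum_biUnion hdisj]
  exact (summable_kernel hF z).sum_le_tsum _ fun y _ => (hF.pos _ (len_nonneg (z - y))).le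

/-- A product of nonnegative functions with bounded partial sums is summable. -/
theorem summable_prod_pi {ι : Type*} [Fintype ι] {κ : ι → Type*} {h : ∀ i, κ i → ℝ}
    {c : ι → ℝ} (h0 : ∀ i n, 0 ≤ h i n) (hc : ∀ i (v : Finset (κ i)), ∑ n ∈ v, h i n ≤ c i) :
    Summable fun n : (i : ι) → κ i => ∏ i, h i (n i) := by
  classical
  refine summable_of_sum_le (c := ∏ i, c i)
    (fun n => Finset.prod_nonneg fun i _ => h0 i (n i)) fun u => ?_
  calc _ ≤ ∑ n ∈ Fintype.piFinset fun i => u.image fun n => n i, ∏ i, h i (n i) := by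
        refine Finset.sum_le_sum_of_subset_of_nonneg (fun n hn => ?_)
          fun n _ _ => Finset.prod_nonneg fun i _ => h0 i (n i)
        exact Fintype.mem_piFinset.mpr fun i => Finset.mem_image_of_mem _ hn
    _ = ∏ i, ∑ n ∈ u.image fun n => n i, h i n := (Finset.prod_univ_sum _ _).symm
    _ ≤ _ := Finset.prod_le_prod (fun i _ => Finset.sum_nonneg fun n _ => h0 i n) fun i _ => hc i _

/-- Every nonempty subset of `{1, …, k}` is the range of a strictly increasing map. -/
theorem exists_incMaps {k : ℕ} {J : Finset ℕ} (hJ : J ⊆ Finset.Icc 1 k) (hne : J.Nonempty) :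
    ∃ l ∈ Finset.Icc 1 k, ∃ π : IncMaps l k, ∀ j, j ∈ J ↔ ∃ i, (π.1 i : ℕ) = j := by
  have hcard : J.card ≤ k := by simpa using Finset.card_le_card hJ
  have hpos : 0 < J.card := hne.card_pos
  have hl : (Finset.Icc (k + 1 - J.card) k).card = J.card := by
    rw [Nat.card_Icc]
    omega
  let e : Finset.Icc (k + 1 - J.card) k ≃o J :=
    ((Finset.Icc (k + 1 - J.card) k).orderIsoOfFin hl).symm.trans (J.orderIsoOfFin rfl)
  refine ⟨k + 1 - J.card, Finset.mem_Icc.mpr (by omega),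
    ⟨fun i => ⟨e i, hJ (e i).2⟩, fun i i' h => e.strictMono h⟩, fun j => ⟨fun hj => ?_, ?_⟩⟩
  · exact ⟨e.symm ⟨j, hj⟩, by simp⟩
  · rintro ⟨i, rfl⟩
    exact (e i).2

variable {F : ℝ → ℝ} {α : ℝ} (m : ℕ → ℕ) (s : ℕ → ℝ) (x : ℕ → Site d) (k : ℕ)
  (T : Finset (Sym2 ℕ))

/-- The contribution of the layers `ν` to the bound, for the tree `T`. -/
def layerTerm (F : ℝ → ℝ) (α : ℝ) (m : ℕ → ℕ) (s : ℕ → ℝ) (x : ℕ → Site d) (k : ℕ)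
    (T : Finset (Sym2 ℕ)) (ν : ℕ → ℕ) : ℝ :=
  overlap k T ν x * ∏ j ∈ Finset.Icc 1 k, layerWeight d F α (s j) (m j) (ν j)

theorem layerTerm_nonneg (hF : IsDecayFunction d F) (hα : 0 ≤ α) (ν : ℕ → ℕ) :
    0 ≤ layerTerm F α m s x k T ν :=
  mul_nonneg (overlap_nonneg _ _ _ _)
    (Finset.prod_nonneg fun _ _ => layerWeight_nonneg hF hα _ _ _)

theorem layerTerm_extend {l : ℕ} (hl : l ≤ k) (π : IncMaps l k)
    (n : (i : Finset.Icc l k) → {n : ℕ // m (π.1 i) + 1 ≤ n}) :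
    layerTerm F α m s x k T (Function.extend (fun i => (π.1 i : ℕ)) (fun i => (n i : ℕ)) m)
      = (2 * α) ^ (k - l + 1) *
        (∏ i : Finset.Icc l k, |s (π.1 i)| * Real.exp (4 * convConst d F * α * |s (π.1 i)|)) *
        ∑ z ∈ Fintype.piFinset fun i : Finset.Icc l k => box d (m (π.1 i)),
          ∑ y ∈ Fintype.piFinset fun i : Finset.Icc l k =>
              box d ((n i : ℕ) : ℝ) \ box d (((n i : ℕ) : ℝ) - 1),
            overlap k T (Function.extend (fun i => (π.1 i : ℕ)) (fun i => (n i : ℕ)) m) x *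
              ∏ i : Finset.Icc l k, F (len (z i - y i)) := by
  have hinj : Function.Injective fun i : Finset.Icc l k => (π.1 i : ℕ) :=
    Subtype.val_injective.comp π.2.injective
  set ν := Function.extend (fun i => (π.1 i : ℕ)) (fun i => (n i : ℕ)) m with hν
  have hprod : ∏ j ∈ Finset.Icc 1 k, layerWeight d F α (s j) (m j) (ν j)
      = ∏ i : Finset.Icc l k, layerWeight d F α (s (π.1 i)) (m (π.1 i)) (n i) := by
    have himg : Finset.univ.image (fun i : Finset.Icc l k => (π.1 i : ℕ)) ⊆ Finset.Icc 1 k := by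
      intro j hj
      obtain ⟨i, -, rfl⟩ := Finset.mem_image.mp hj
      exact (π.1 i).2
    rw [← Finset.prod_subset himg, Finset.prod_image hinj.injOn]
    · exact Finset.prod_congr rfl fun i _ => by rw [hν, hinj.extend_apply]
    · intro j _ hj
      have : ν j = m j := Function.extend_apply' _ _ _ fun ⟨i, hi⟩ =>
        hj (Finset.mem_image.mpr ⟨i, Finset.mem_univ i, hi⟩)
      rw [layerWeight, if_pos this]
  have hw : ∀ i : Finset.Icc l k, layerWeight d F α (s (π.1 i)) (m (π.1 i)) (n i)
      = 2 * α * (|s (π.1 i)| * Real.exp (4 * convConst d F * α * |s (π.1 i)|))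
        * shellSum d F (m (π.1 i)) (n i) := fun i => by
    have := (n i).2
    rw [layerWeight, if_neg (by omega)]
  have hshell : ∏ i : Finset.Icc l k, shellSum d F (m (π.1 i)) (n i)
      = ∑ z ∈ Fintype.piFinset fun i : Finset.Icc l k => box d (m (π.1 i)),
          ∑ y ∈ Fintype.piFinset fun i : Finset.Icc l k =>
              box d ((n i : ℕ) : ℝ) \ box d (((n i : ℕ) : ℝ) - 1),
            ∏ i : Finset.Icc l k, F (len (z i - y i)) := by
    simp only [shellSum, Finset.prod_univ_sum]
  rw [layerTerm, hprod, Finset.prod_congr rfl fun i _ => hw i, Finset.prod_mul_distrib,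
    Finset.prod_mul_distrib, hshell, Finset.prod_const, Finset.card_univ, Fintype.card_coe,
    Nat.card_Icc, Nat.sub_add_comm hl]
  simp only [← Finset.mul_sum]
  ring

theorem summable_remainder (hF : IsDecayFunction d F) {l : ℕ} (π : IncMaps l k) :
    Summable fun n : (i : Finset.Icc l k) → {n : ℕ // m (π.1 i) + 1 ≤ n} =>
        ∑ z ∈ Fintype.piFinset fun i : Finset.Icc l k => box d (m (π.1 i)),
          ∑ y ∈ Fintype.piFinset fun i : Finset.Icc l k =>
              box d ((n i : ℕ) : ℝ) \ box d (((n i : ℕ) : ℝ) - 1),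
            overlap k T (Function.extend (fun i => (π.1 i : ℕ)) (fun i => (n i : ℕ)) m) x *
              ∏ i : Finset.Icc l k, F (len (z i - y i)) := by
  have hpos : ∀ z y : Finset.Icc l k → Site d, 0 ≤ ∏ i, F (len (z i - y i)) := fun z y =>
    Finset.prod_nonneg fun i _ => (hF.pos _ (len_nonneg _)).le
  have hs : Summable fun n : (i : Finset.Icc l k) → {n : ℕ // m (π.1 i) + 1 ≤ n} =>
      ∏ i, shellSum d F (m (π.1 i)) (n i) := by
    refine summable_prod_pi (h := fun i (n : {n : ℕ // m (π.1 i) + 1 ≤ n}) =>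
      shellSum d F (m (π.1 i)) n)
      (c := fun i => ∑ z ∈ box d (m (π.1 i)), ∑' y : Site d, F (len (z - y)))
      (fun i n => shellSum_nonneg hF _ _) fun i v => ?_
    have := sum_shellSum_le hF (m (π.1 i)) (v.map (Function.Embedding.subtype _))
    rwa [Finset.sum_map] at this
  refine Summable.of_nonneg_of_le (fun n => ?_) (fun n => ?_) hs
  · exact Finset.sum_nonneg fun z _ => Finset.sum_nonneg fun y _ =>
      mul_nonneg (overlap_nonneg _ _ _ _) (hpos z y)
  · simp only [shellSum, Finset.prod_univ_sum]
    exact Finset.sum_le_sum fun z _ => Finset.sum_le_sum fun y _ =>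
      mul_le_of_le_one_left (hpos z y) (overlap_le_one _ _ _ _)

open Classical in
/-- The contribution of the layers that differ from `m` exactly on the range of `π`. -/
theorem sum_layerTerm_le (hF : IsDecayFunction d F) (hα : 0 ≤ α) {l : ℕ}
    (hl : l ≤ k) (π : IncMaps l k) (s₀ : Finset (ℕ → ℕ))
    (hs₀ : ∀ ν ∈ s₀, (∀ j, m j ≤ ν j) ∧ ∀ j, ν j ≠ m j ↔ ∃ i, (π.1 i : ℕ) = j) :
    ∑ ν ∈ s₀, layerTerm F α m s x k T ν
      ≤ (2 * α) ^ (k - l + 1) *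
        ((∏ i : Finset.Icc l k, |s (π.1 i)| * Real.exp (4 * convConst d F * α * |s (π.1 i)|)) *
        ∑' n : (i : Finset.Icc l k) → {n : ℕ // m (π.1 i) + 1 ≤ n},
          ∑ z ∈ Fintype.piFinset fun i : Finset.Icc l k => box d (m (π.1 i)),
          ∑ y ∈ Fintype.piFinset fun i : Finset.Icc l k =>
              box d ((n i : ℕ) : ℝ) \ box d (((n i : ℕ) : ℝ) - 1),
            overlap k T (Function.extend (fun i => (π.1 i : ℕ)) (fun i => (n i : ℕ)) m) x *
              ∏ i : Finset.Icc l k, F (len (z i - y i))) := by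
  have hinj : Function.Injective fun i : Finset.Icc l k => (π.1 i : ℕ) :=
    Subtype.val_injective.comp π.2.injective
  let ext := fun n : (i : Finset.Icc l k) → {n : ℕ // m (π.1 i) + 1 ≤ n} =>
    Function.extend (fun i => (π.1 i : ℕ)) (fun i => (n i : ℕ)) m
  let res : (ℕ → ℕ) → (i : Finset.Icc l k) → {n : ℕ // m (π.1 i) + 1 ≤ n} := fun ν i =>
    ⟨max (ν (π.1 i)) (m (π.1 i) + 1), le_max_right _ _⟩
  have hext : ∀ ν ∈ s₀, ext (res ν) = ν := by
    intro ν hν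
    obtain ⟨h1, h2⟩ := hs₀ ν hν
    funext j
    by_cases hj : ∃ i, (π.1 i : ℕ) = j
    · obtain ⟨i, rfl⟩ := hj
      have h3 := (h2 _).mpr ⟨i, rfl⟩
      have h4 := h1 (π.1 i)
      change Function.extend (fun i => (π.1 i : ℕ)) _ m _ = _
      rw [hinj.extend_apply]
      exact max_eq_left (by omega)
    · change Function.extend (fun i => (π.1 i : ℕ)) _ m _ = _
      rw [Function.extend_apply' _ _ _ hj]
      exact (not_not.mp fun h => hj ((h2 j).mp h)).symm
  have hsum := (summable_remainder m x k T hF π).mul_left ((2 * α) ^ (k - l + 1) *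
    ∏ i : Finset.Icc l k, |s (π.1 i)| * Real.exp (4 * convConst d F * α * |s (π.1 i)|))
  rw [← mul_assoc, ← tsum_mul_left]
  simp only [← layerTerm_extend m s x k T hl π] at hsum ⊢
  calc _ = ∑ ν ∈ s₀, layerTerm F α m s x k T (ext (res ν)) :=
        Finset.sum_congr rfl fun ν hν => by rw [hext ν hν]
    _ = ∑ n ∈ s₀.image res, layerTerm F α m s x k T (ext n) := by
        rw [Finset.sum_image]
        intro ν hν ν' hν' h
        rw [← hext ν hν, ← hext ν' hν', h]
    _ ≤ _ := hsum.sum_le_tsum _ fun n _ => layerTerm_nonneg m s x k T hF hα _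

theorem sum_choices_layerTerm_le (hF : IsDecayFunction d F) (hα : 0 ≤ α) (N : ℕ) :
    ∑ ν ∈ choices m (fun j => Finset.Icc (m j) N) k, layerTerm F α m s x k T ν
      ≤ overlap k T m x + remainder F k T m s x α := by
  classical
  set 𝒞 := choices m (fun j => Finset.Icc (m j) N) k with h𝒞
  have hnn := layerTerm_nonneg m s x k T hF hα
  have hle : ∀ ν ∈ 𝒞, ∀ j, m j ≤ ν j := by
    intro ν hν j
    obtain ⟨h1, h2, h3⟩ := of_mem_choices hν
    rcases Nat.eq_zero_or_pos j with rfl | hj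
    · exact h2.ge
    · rcases le_or_gt j k with hk | hk
      · exact (Finset.mem_Icc.mp (h1 j hj hk)).1
      · exact (h3 j hk).ge
  have hbase : layerTerm F α m s x k T m = overlap k T m x := by
    simp [layerTerm, layerWeight]
  have hcover : ∀ ν ∈ 𝒞, layerTerm F α m s x k T ν
      ≤ (if ν = m then overlap k T m x else 0)
        + ∑ l ∈ Finset.Icc 1 k, ∑ π : IncMaps l k,
          if ∀ j, ν j ≠ m j ↔ ∃ i, (π.1 i : ℕ) = j then layerTerm F α m s x k T ν else 0 := by
    intro ν hν
    have hterm : ∀ l (π : IncMaps l k),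
        0 ≤ if ∀ j, ν j ≠ m j ↔ ∃ i, (π.1 i : ℕ) = j then layerTerm F α m s x k T ν else 0 := by
      intro l π
      split_ifs
      exacts [hnn ν, le_rfl]
    by_cases hm : ν = m
    · rw [if_pos hm]
      have : layerTerm F α m s x k T ν = overlap k T m x := by rw [hm, hbase]
      rw [this]
      exact le_add_of_nonneg_right (Finset.sum_nonneg fun l _ => Finset.sum_nonneg fun π _ => by
        split_ifs
        exacts [overlap_nonneg _ _ _ _, le_rfl])
    · obtain ⟨h1, h2, h3⟩ := of_mem_choices hν
      have hmem : ∀ j, ν j ≠ m j → j ∈ Finset.Icc 1 k := by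
        intro j hj
        rw [Finset.mem_Icc]
        refine ⟨Nat.one_le_iff_ne_zero.mpr ?_, not_lt.mp fun h => hj (h3 j h)⟩
        rintro rfl
        exact hj h2
      obtain ⟨l, hl, π, hπ⟩ := exists_incMaps (k := k)
        (J := (Finset.Icc 1 k).filter fun j => ν j ≠ m j) (Finset.filter_subset _ _) (by
          obtain ⟨j, hj⟩ := Function.ne_iff.mp hm
          exact ⟨j, Finset.mem_filter.mpr ⟨hmem j hj, hj⟩⟩)
      have hπ' : ∀ j, ν j ≠ m j ↔ ∃ i, (π.1 i : ℕ) = j := fun j => by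
        rw [← hπ j, Finset.mem_filter]
        exact ⟨fun h => ⟨hmem j h, h⟩, fun h => h.2⟩
      rw [if_neg hm, zero_add]
      calc _ = if ∀ j, ν j ≠ m j ↔ ∃ i, (π.1 i : ℕ) = j then layerTerm F α m s x k T ν else 0 := by
            rw [if_pos hπ']
        _ ≤ ∑ π : IncMaps l k, if ∀ j, ν j ≠ m j ↔ ∃ i, (π.1 i : ℕ) = j
              then layerTerm F α m s x k T ν else 0 :=
            Finset.single_le_sum (f := fun π : IncMaps l k =>
              if ∀ j, ν j ≠ m j ↔ ∃ i, (π.1 i : ℕ) = j then layerTerm F α m s x k T ν else 0)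
              (fun π _ => hterm l π) (Finset.mem_univ π)
        _ ≤ _ := Finset.single_le_sum (f := fun l => ∑ π : IncMaps l k,
              if ∀ j, ν j ≠ m j ↔ ∃ i, (π.1 i : ℕ) = j then layerTerm F α m s x k T ν else 0)
              (fun l _ => Finset.sum_nonneg fun π _ => hterm l π) hl
  refine (Finset.sum_le_sum hcover).trans ?_
  rw [Finset.sum_add_distrib]
  refine add_le_add ?_ ?_
  · rw [Finset.sum_ite_eq' 𝒞 m fun _ => overlap k T m x]
    split_ifs
    exacts [le_rfl, overlap_nonneg _ _ _ _]
  · rw [Finset.sum_comm, remainder]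
    refine Finset.sum_le_sum fun l hl => ?_
    rw [Finset.sum_comm, Finset.mul_sum]
    refine Finset.sum_le_sum fun π _ => ?_
    rw [← Finset.sum_filter]
    exact sum_layerTerm_le m s x k T hF hα (Finset.mem_Icc.mp hl).2 π _ fun ν hν =>
      ⟨hle ν (Finset.mem_filter.mp hν).1, (Finset.mem_filter.mp hν).2⟩

end Remainder

section Main

variable {d : ℕ} {F : ℝ → ℝ}

theorem norm_multiCommutator_evolve_le (hF : IsDecayFunction d F) {Ψ : Interaction d}
    (hΨ : Ψ.eNormW F < ⊤) (V : Potential d) {k : ℕ} {m : ℕ → ℕ} (s : ℕ → ℝ) {x : ℕ → Site d}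
    {B : ℕ → CAR d} (hB : ∀ j ≤ k, B j ∈ localAlgebra (shiftedBox (m j) (x j)))
    (he : ∀ j, 1 ≤ j → j ≤ k → IsEven (B j)) {N : ℕ} (hN : ∀ j ≤ k, m j ≤ N) :
    ‖multiCommutator (fun j => if j = 0 then B 0
        else evolve ((fermionModel Ψ V).ham (shiftedBox N (x j))) (s j) (B j)) k‖
      ≤ 2 ^ k * (∏ j ∈ Finset.range (k + 1), ‖B j‖) *
        ∑ T ∈ trees k, (overlap k T m x + remainder F k T m s x (Ψ.normW F)) := by
  set b : ℕ → ℕ → CAR d := fun j n =>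
    if j = 0 then B 0 else layer Ψ V (s j) (x j) (m j) (B j) n with hb
  set S : ℕ → Finset ℕ := fun j => Finset.Icc (m j) N with hS
  have hexp : multiCommutator (fun j => if j = 0 then B 0
        else evolve ((fermionModel Ψ V).ham (shiftedBox N (x j))) (s j) (B j)) k
      = ∑ ν ∈ choices m S k, multiCommutator (fun j => b j (ν j)) k := by
    rw [← multiCommutator_sum]
    refine multiCommutator_congr fun j hj => ?_
    by_cases h0 : j = 0
    · simp [h0, hb]
    · simp only [h0, hb, if_false]
      exact (sum_layer Ψ V (s j) (x j) (m j) (B j) (hN j hj)).symm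
  have hbound : ∀ ν ∈ choices m S k, ‖multiCommutator (fun j => b j (ν j)) k‖
      ≤ 2 ^ k * (∏ j ∈ Finset.range (k + 1), ‖B j‖) *
        ∑ T ∈ trees k, layerTerm F (Ψ.normW F) m s x k T ν := by
    intro ν hν
    obtain ⟨h1, h2, -⟩ := of_mem_choices hν
    have hm : ∀ j, 1 ≤ j → j ≤ k → m j ≤ ν j := fun j hj hk => (Finset.mem_Icc.mp (h1 j hj hk)).1
    refine (norm_multiCommutator_le_overlap (n := ν) (x := x) (fun j hj => ?_)
      (fun j hj hk => ?_)).trans ?_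
    · by_cases h0 : j = 0
      · subst h0
        rw [h2]
        exact localAlgebra_le_localClosure _ (hB 0 hj)
      · simp only [hb, h0, if_false]
        exact layer_mem Ψ V (s j) (hB j hj) (hm j (by omega) hj)
    · simp only [hb, show j ≠ 0 by omega, if_false]
      exact isEven_layer Ψ V (s j) (x j) (m j) (he j hj hk) (ν j)
    · have hprod : ∏ j ∈ Finset.range (k + 1), ‖b j (ν j)‖
          ≤ (∏ j ∈ Finset.range (k + 1), ‖B j‖)
            * ∏ j ∈ Finset.Icc 1 k, layerWeight d F (Ψ.normW F) (s j) (m j) (ν j) := by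
        have hr : Finset.range (k + 1) = insert 0 (Finset.Icc 1 k) := by
          ext j
          simp only [Finset.mem_range, Finset.mem_insert, Finset.mem_Icc]
          omega
        rw [hr, Finset.prod_insert (by simp), Finset.prod_insert (by simp), mul_assoc,
          ← Finset.prod_mul_distrib]
        refine mul_le_mul (by simp [hb]) ?_ (Finset.prod_nonneg fun _ _ => norm_nonneg _)
          (norm_nonneg _)
        refine Finset.prod_le_prod (fun _ _ => norm_nonneg _) fun j hj => ?_
        obtain ⟨hj1, hjk⟩ := Finset.mem_Icc.mp hj
        simp only [hb, show j ≠ 0 by omega, if_false]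
        exact norm_layer_le hF hΨ V (s j) (hB j hjk) (hm j hj1 hjk)
      simp only [layerTerm, ← Finset.sum_mul]
      calc _ ≤ 2 ^ k * ((∏ j ∈ Finset.range (k + 1), ‖B j‖)
              * ∏ j ∈ Finset.Icc 1 k, layerWeight d F (Ψ.normW F) (s j) (m j) (ν j))
              * ∑ T ∈ trees k, overlap k T ν x := by
            refine mul_le_mul_of_nonneg_right (mul_le_mul_of_nonneg_left hprod (by positivity))
              (Finset.sum_nonneg fun T _ => overlap_nonneg _ _ _ _)
        _ = _ := by ring
  rw [hexp]
  refine (norm_sum_le _ _).trans ((Finset.sum_le_sum hbound).trans ?_)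
  rw [← Finset.mul_sum, Finset.sum_comm]
  refine mul_le_mul_of_nonneg_left (Finset.sum_le_sum fun T _ => ?_) (by positivity)
  exact sum_choices_layerTerm_le m s x k T hF (normW_nonneg F Ψ) N

end Main

end MultiLR

end

theorem mainTheorem1 {d : ℕ} {F : ℝ → ℝ} (hF : MultiLR.IsDecayFunction d F)
    (Ψ : MultiLR.Interaction d) (hΨ : Ψ.eNormW F < ⊤) (V : MultiLR.Potential d) :
    (∀ (t : ℝ) (B : MultiLR.CAR d),
      Filter.Tendsto (fun L : ℝ => MultiLR.finiteDynamics Ψ V L t B) Filter.atTop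
        (nhds (MultiLR.dynamics Ψ V t B))) ∧
    ∀ (k : ℕ), 1 ≤ k → ∀ (m : ℕ → ℕ) (s : ℕ → ℝ) (x : ℕ → MultiLR.Site d)
      (B : ℕ → MultiLR.CAR d),
      (∀ j ≤ k, B j ∈ MultiLR.localAlgebra (MultiLR.box d (m j))) →
      (∀ j, 1 ≤ j → j ≤ k → MultiLR.IsEven (B j)) →
      ‖MultiLR.multiCommutator
          (fun j => if j = 0 then MultiLR.translation (x 0) (B 0)
            else MultiLR.dynamics Ψ V (s j) (MultiLR.translation (x j) (B j))) k‖
        ≤ 2 ^ k * (∏ j ∈ Finset.range (k + 1), ‖B j‖) *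
          ∑ T ∈ MultiLR.trees k,
            (MultiLR.overlap k T m x + MultiLR.remainder F k T m s x (Ψ.normW F)) := by
  refine ⟨MultiLR.tendsto_finiteDynamics hF hΨ V, fun k _ m s x B hB he => ?_⟩
  have hlim := MultiLR.tendsto_multiCommutator (k := k)
    (B := fun N j => if j = 0 then MultiLR.translation (x 0) (B 0)
      else MultiLR.evolve ((MultiLR.fermionModel Ψ V).ham (MultiLR.shiftedBox N (x j))) (s j)
        (MultiLR.translation (x j) (B j)))
    (C := fun j => if j = 0 then MultiLR.translation (x 0) (B 0)
      else MultiLR.dynamics Ψ V (s j) (MultiLR.translation (x j) (B j)))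
    (fun j _ => by
      by_cases h0 : j = 0
      · simp only [h0, if_true]
        exact tendsto_const_nhds
      · simp only [h0, if_false]
        exact (MultiLR.tendsto_evolve_dynamics hF hΨ V (s j) _).comp
          (MultiLR.tendsto_shiftedBox (x j)))
  refine le_of_tendsto hlim.norm ?_
  filter_upwards [Filter.eventually_ge_atTop (∑ j ∈ Finset.range (k + 1), m j)] with N hN
  have h := MultiLR.norm_multiCommutator_evolve_le hF hΨ V s (k := k) (m := m) (x := x)
    (B := fun j => MultiLR.translation (x j) (B j)) (N := N)
    (fun j hj => MultiLR.translation_mem_localAlgebra (x j) (hB j hj))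
    (fun j h1 hk => (he j h1 hk).translation (x j) (hB j hk))
    (fun j hj => (Finset.single_le_sum (f := m) (fun _ _ => Nat.zero_le _)
      (Finset.mem_range.mpr (by omega))).trans hN)
  simpa only [MultiLR.norm_starAlgEquiv] using h
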